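/- Let $S^2\subset\mathbb R^3$ be the unit sphere, $\triangle=\frac1{\sin\theta}\partial_\theta(\sin\theta\,\partial_\theta)+\frac1{\sin^2\theta}\partial_\phi^2$ its Laplace operator and $Y_l^m(\theta,\phi)=\sqrt{\frac{2l+1}{4\pi}\frac{(l-m)!}{(l+m)!}}\,P_l^m(\cos\theta)e^{im\phi}$ ($l\in\mathbb N_0$, $-l\le m\le l$) the spherical harmonics, $P_l^m$ being the associated Legendre functions. Let $I\subseteq\mathbb R$ be an open interval. A function $h:I\times S^2\to\mathbb C$ is called regular if $h(u,\cdot)$ is $C^\infty$ on the whole sphere for every $u\in I$. Let $P,Q$ be polynomials with complex coefficients, and put $$\Xi=\{l\in\mathbb N_0: P(-l(l+1))=Q(-l(l+1))=0\},\quad \Sigma=\{l\in\mathbb N_0: Q(-l(l+1))\ne0\},\quad \lambda_l=\frac{P(-l(l+1))}{Q(-l(l+1))}\ \ (l\in\Sigma).$$ All series over $l$ below converge unconditionally and uniformly on $S^2$ for each fixed $u\in I$. 1. (Heat equation.) A regular $h$ solves $P(\triangle)h=\partial_u Q(\triangle)h$ (in the sense that at every point $Q(\triangle)h$ is differentiable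 in $u$ with derivative $P(\triangle)h$, and this derivative is continuous on $I\times S^2$) if and only if there are functions $h_l^m:I\to\mathbb C$ ($l\in\Xi$) and constants $c_l^m\in\mathbb C$ ($l\in\Sigma$) such that $$h(u,\cdot)=\sum_{l\in\Xi}\sum_{m=-l}^{l}h_l^m(u)\,Y_l^m+\sum_{l\in\Sigma}\sum_{m=-l}^{l}c_l^m e^{\lambda_l u}\,Y_l^m\qquad(u\in I).$$ The functions $h_l^m$ and the constants $c_l^m$ are arbitrary: for any choice of them, every such sum over finitely many $l$ is a regular solution. 2. (Laplace equation.) A regular $h$ satisfies $P(\triangle)h=0$ if and only if $h(u,\cdot)=\sum_{l:\,P(-l(l+1))=0}\sum_{m=-l}^{l}h_l^m(u)Y_l^m$ for all $u\in I$, with some functions $h_l^m:I\to\mathbb C$. 3. (Poisson equation.) Let $C:I\to\mathbb C$. If $P(0)=0$ and $C$ is not identically zero, then $P(\triangle)h=C(u)$ has no regular solution on $I\times S^2$. If $P(0)\neq0$, then a regular $h$ satisfies $P(\triangle)h=C(u)$ if and only if $h(u,\cdot)=\frac{C(u)}{P(0)}+\sum_{l:\,P(-l(l+1))=0}\sum_{m=-l}^{l}h_l^m(u)Y_l^m$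 for all $u\in I$, with some functions $h_l^m:I\to\mathbb C$. 4. Let $K\in\mathbb C$. If $(\triangle+K)\triangle h=0$ has a regular solution $h$ for which $h(u,\cdot)$ is non-constant on $S^2$ for some $u\in I$, then $K=l(l+1)$ for some positive integer $l$. -/

import Mathlib

open scoped Manifold ContDiff Polynomial

noncomputable section

/-- The unit sphere `S²` in Euclidean space `ℝ³`. -/
abbrev S2 : Type := Metric.sphere (0 : EuclideanSpace ℝ (Fin 3)) 1

/-- A complex-valued function on the sphere is regular if it is smooth on the whole sphere
(poles included), for the standard smooth structure of `S²`. -/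
def IsRegularOnSphere (f : S2 → ℂ) : Prop :=
  ContMDiff (𝓡 2) 𝓘(ℝ, ℂ) ∞ f

/-- The extension of `f : S² → ℂ` to `ℝ³ ∖ {0}` that is constant along rays,
`y ↦ f (y / ‖y‖)` (with the irrelevant value `0` at the origin). -/
def radialExtension (f : S2 → ℂ) (y : EuclideanSpace ℝ (Fin 3)) : ℂ :=
  open Classical in
  if hy : y = 0 then 0 else f ⟨‖y‖⁻¹ • y, by
    rw [mem_sphere_zero_iff_norm, norm_smul, norm_inv, norm_norm,
      inv_mul_cancel₀ (norm_ne_zero_iff.mpr hy)]⟩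

/-- The Laplace-Beltrami operator of the round unit sphere: the Euclidean Laplacian of the
extension that is constant along rays, restricted to the sphere. In spherical coordinates this is
`(1 / sin θ) ∂_θ (sin θ ∂_θ f) + (1 / sin² θ) ∂_φ² f`, because the Euclidean Laplacian is
`∂_r² + (2 / r) ∂_r + r⁻² △`. -/
def sphereLaplacian (f : S2 → ℂ) : S2 → ℂ :=
  fun x => Laplacian.laplacian (radialExtension f) (x : EuclideanSpace ℝ (Fin 3))

/-- `P(△) f` for a polynomial `P = ∑ₖ aₖ Xᵏ`, that is `∑ₖ aₖ △ᵏ f`. -/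
def polyLaplacian (P : ℂ[X]) (f : S2 → ℂ) : S2 → ℂ :=
  fun x => P.sum fun k a => a * (sphereLaplacian^[k] f) x

/-- The Legendre polynomial `P_l`, by the formula of Rodrigues. -/
def legendrePoly (l : ℕ) : ℝ[X] :=
  Polynomial.C (1 / (2 ^ l * (l.factorial : ℝ))) *
    Polynomial.derivative^[l] ((Polynomial.X ^ 2 - 1) ^ l)

/-- The associated Legendre function of order `m ≥ 0`,
`P_l^m(z) = (-1)^m (1 - z²)^{m/2} (d/dz)^m P_l(z)`. -/
def assocLegendreNat (l m : ℕ) (z : ℝ) : ℝ :=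
  (-1) ^ m * Real.sqrt (1 - z ^ 2) ^ m * (Polynomial.derivative^[m] (legendrePoly l)).eval z

/-- The associated Legendre function `P_l^m` of integer order `-l ≤ m ≤ l`, where
`P_l^{-m} = (-1)^m ((l - m)! / (l + m)!) P_l^m` for `m > 0`. -/
def assocLegendre (l : ℕ) (m : ℤ) (z : ℝ) : ℝ :=
  if 0 ≤ m then assocLegendreNat l m.natAbs z
  else (-1) ^ m.natAbs *
    (((l - m.natAbs).factorial : ℝ) / ((l + m.natAbs).factorial : ℝ)) *
      assocLegendreNat l m.natAbs z

/-- The spherical harmonic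
`Y_l^m(θ, φ) = √((2l+1)/(4π) · (l-m)!/(l+m)!) P_l^m(cos θ) e^{imφ}`, for `-l ≤ m ≤ l`,
as a function of the point `x = (sin θ cos φ, sin θ sin φ, cos θ)` of the sphere: `cos θ` is the
last coordinate and `φ` is the argument of `x₀ + i x₁`. -/
def sphericalHarmonic (l : ℕ) (m : ℤ) (x : S2) : ℂ :=
  (Real.sqrt ((2 * (l : ℝ) + 1) / (4 * Real.pi) *
      ((((l : ℤ) - m).toNat.factorial : ℝ) / (((l : ℤ) + m).toNat.factorial : ℝ))) : ℂ) *
    (assocLegendre l m (x.1 2) : ℂ) *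
    Complex.exp (Complex.I * (m : ℂ) * (Complex.arg ⟨x.1 0, x.1 1⟩ : ℂ))

/-- `f = ∑_{l ≥ 0} ∑_{m = -l}^{l} b_l^m Y_l^m`, the series over `l` converging unconditionally and
uniformly on the sphere. -/
def HasHarmonicExpansion (b : ℕ → ℤ → ℂ) (f : S2 → ℂ) : Prop :=
  HasSumUniformlyOn
    (fun (l : ℕ) (x : S2) =>
      ∑ m ∈ Finset.Icc (-(l : ℤ)) (l : ℤ), b l m * sphericalHarmonic l m x)
    f Set.univ

/-- The eigenvalue `-l(l+1)` of the Laplacian of the sphere. -/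
def sphereEigenvalue (l : ℕ) : ℂ := -((l : ℂ) * ((l : ℂ) + 1))

/-- The degrees `l` with `P(-l(l+1)) = Q(-l(l+1)) = 0`. -/
def degreesXi (P Q : ℂ[X]) : Set ℕ :=
  {l | P.eval (sphereEigenvalue l) = 0 ∧ Q.eval (sphereEigenvalue l) = 0}

/-- The degrees `l` with `Q(-l(l+1)) ≠ 0`. -/
def degreesSigma (Q : ℂ[X]) : Set ℕ :=
  {l | Q.eval (sphereEigenvalue l) ≠ 0}

/-- The exponents `λ_l = P(-l(l+1)) / Q(-l(l+1))`, used only for `Q(-l(l+1)) ≠ 0`. -/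
def heatRate (P Q : ℂ[X]) (l : ℕ) : ℂ :=
  P.eval (sphereEigenvalue l) / Q.eval (sphereEigenvalue l)

open Classical in
/-- The coefficients at time `u`: `a_l^m(u)` if `P(-l(l+1)) = Q(-l(l+1)) = 0`,
`c_l^m e^{λ_l u}` if `Q(-l(l+1)) ≠ 0`, and `0` for the remaining degrees. -/
def heatCoeff (P Q : ℂ[X]) (a : ℕ → ℤ → ℝ → ℂ) (c : ℕ → ℤ → ℂ) (u : ℝ) (l : ℕ) (m : ℤ) : ℂ :=
  if l ∈ degreesXi P Q then a l m u
  else if l ∈ degreesSigma Q then c l m * Complex.exp (heatRate P Q l * (u : ℂ))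
  else 0

open Classical in
/-- The coefficients at time `u`: `a_l^m(u)` if `P(-l(l+1)) = 0`, and `0` otherwise. -/
def laplaceCoeff (P : ℂ[X]) (a : ℕ → ℤ → ℝ → ℂ) (u : ℝ) (l : ℕ) (m : ℤ) : ℂ :=
  if P.eval (sphereEigenvalue l) = 0 then a l m u else 0

/-- Regular solutions `h(u, x)`, `u ∈ I`, `x ∈ S²`, of `P(△) h = ∂_u Q(△) h`: every `h(u, ·)` is
smooth on the sphere, `Q(△) h` is differentiable in `u` with derivative `P(△) h` at every point,
and this derivative is continuous in `(u, x)`. Nothing else is required of the dependence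
on `u`. -/
structure IsRegularHeatSolution (I : Set ℝ) (P Q : ℂ[X]) (h : ℝ → S2 → ℂ) : Prop where
  regular : ∀ u ∈ I, IsRegularOnSphere (h u)
  equation : ∀ u ∈ I, ∀ x : S2,
    HasDerivAt (fun t : ℝ => polyLaplacian Q (h t) x) (polyLaplacian P (h u) x) u
  continuous_deriv :
    ContinuousOn (fun p : ℝ × S2 => polyLaplacian P (h p.1) p.2) (I ×ˢ Set.univ)

end

/-! Everything rests on harmonic analysis on the sphere: each smooth `f` is the uniform sum of its
expansion in spherical harmonics, and `△` acts on the coefficients as multiplication by `-l(l+1)`.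
Each equation then decouples into one scalar condition per pair `(l, m)`: an algebraic one for
Laplace, Poisson and `(△ + K)△`, and the linear equation `Q(-l(l+1)) b' = P(-l(l+1)) b` with
constant factors for heat.

The eigenfunction property comes from writing `Y_l^m` as a multiple of `(x₀ ± i x₁)^|m| q(x₂)` with
`q` a derivative of the Legendre polynomial. On such functions `△` becomes an ordinary differential
operator in `q` (`sphereLaplacian_sectorial`), and Legendre's equation does the rest. Symmetry of
`△` (`integral_sphereLaplacian_mul`) is Green's identity in `ℝ³` applied to cut-off radial
extensions. The measure is the image of a weighted Lebesgue measure, so its total mass and the norms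
of the `Y_l^m` remain unknown; coefficients are divided by the norm squares. Stone-Weierstrass gives
completeness (`dense_harmonicSpan`).

For convergence, the reproducing kernel of an eigenspace is rotation invariant, hence constant on
the diagonal, which bounds `|Y_l^m|` in terms of its own norm. Applying powers of `△` then gives
rapid decay of the terms (`exists_harmonicCoeff_decay`).

For the heat equation, differentiating under the integral gives the equation for the coefficients.
Conversely, the given smooth functions at two nearby times already decay rapidly in `l`, and
`|e^{λ_l t}|` is monotone in `t`, so the differentiated series is dominated between those times
(`exists_summable_bound_heatTerm`). The uncontrolled functions of `u` in the degrees of `Ξ` are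
killed by both `P(△)` and `Q(△)`. -/

open scoped Manifold ContDiff Polynomial

open MeasureTheory

/-! ### Radial extension and smoothness on the sphere -/

/-- The ambient space `ℝ³`. -/
abbrev R3 : Type := EuclideanSpace ℝ (Fin 3)

instance fact_finrank_R3 : Fact (Module.finrank ℝ R3 = 2 + 1) :=
  ⟨finrank_euclideanSpace_fin⟩

/-- The north pole of the sphere. -/
noncomputable def northPole : S2 := ⟨EuclideanSpace.single 2 1, by simp⟩

lemma norm_inv_smul_mem_sphere {y : R3} (hy : y ≠ 0) :
    ‖y‖⁻¹ • y ∈ Metric.sphere (0 : R3) 1 := by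
  rw [mem_sphere_zero_iff_norm, norm_smul, norm_inv, norm_norm,
    inv_mul_cancel₀ (norm_ne_zero_iff.mpr hy)]

open Classical in
/-- The central projection of `ℝ³ ∖ {0}` onto the sphere. -/
noncomputable def sphereProj (y : R3) : S2 :=
  if hy : y = 0 then northPole else ⟨‖y‖⁻¹ • y, norm_inv_smul_mem_sphere hy⟩

lemma coe_sphereProj {y : R3} (hy : y ≠ 0) : (sphereProj y : R3) = ‖y‖⁻¹ • y := by
  simp [sphereProj, hy]

lemma S2.coe_ne_zero (x : S2) : (x : R3) ≠ 0 := ne_zero_of_mem_unit_sphere x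

lemma S2.norm_coe (x : S2) : ‖(x : R3)‖ = 1 := norm_eq_of_mem_sphere x

lemma sphereProj_coe (x : S2) : sphereProj (x : R3) = x := by
  ext1
  rw [coe_sphereProj x.coe_ne_zero, x.norm_coe, inv_one, one_smul]

lemma sphereProj_smul {c : ℝ} (hc : 0 < c) {y : R3} (hy : y ≠ 0) :
    sphereProj (c • y) = sphereProj y := by
  ext1
  rw [coe_sphereProj hy, coe_sphereProj (smul_ne_zero hc.ne' hy), norm_smul, Real.norm_of_nonneg
    hc.le, smul_smul]
  congr 1
  field_simp

lemma radialExtension_of_ne (f : S2 → ℂ) {y : R3} (hy : y ≠ 0) :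
    radialExtension f y = f (sphereProj y) := by
  simp [radialExtension, sphereProj, hy]

lemma radialExtension_coe (f : S2 → ℂ) (x : S2) : radialExtension f x = f x := by
  rw [radialExtension_of_ne f x.coe_ne_zero, sphereProj_coe]

lemma radialExtension_smul (f : S2 → ℂ) {c : ℝ} (hc : 0 < c) (y : R3) :
    radialExtension f (c • y) = radialExtension f y := by
  rcases eq_or_ne y 0 with rfl | hy
  · simp
  · rw [radialExtension_of_ne f hy, radialExtension_of_ne f (smul_ne_zero hc.ne' hy),
      sphereProj_smul hc hy]

lemma IsRegularOnSphere.contDiffAt_radialExtension {f : S2 → ℂ} (hf : IsRegularOnSphere f)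
    {y : R3} (hy : y ≠ 0) : ContDiffAt ℝ ∞ (radialExtension f) y := by
  let U : TopologicalSpace.Opens R3 := ⟨{0}ᶜ, isOpen_compl_singleton⟩
  have hU (z : U) : (z : R3) ≠ 0 := z.2
  have h1 : ContMDiff 𝓘(ℝ, R3) 𝓘(ℝ, R3) ∞ (fun z : U => ‖(z : R3)‖⁻¹ • (z : R3)) := by
    intro z
    refine (contMDiffAt_subtype_iff (f := fun z : R3 => ‖z‖⁻¹ • z)).mpr ?_
    exact (((contDiffAt_norm ℝ (hU z)).inv (norm_ne_zero_iff.mpr (hU z))).smul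
      contDiffAt_id).contMDiffAt
  have h2 := hf.comp (h1.codRestrict_sphere (n := 2) fun z => norm_inv_smul_mem_sphere (hU z))
  rw [← contMDiffAt_iff_contDiffAt]
  refine (contMDiffAt_subtype_iff (U := U) (x := ⟨y, hy⟩)).mp ?_
  refine (h2 ⟨y, hy⟩).congr_of_eventuallyEq (Filter.Eventually.of_forall fun z => ?_)
  simp only [Function.comp_apply]
  rw [radialExtension_of_ne f (hU z)]
  congr 1
  ext1
  rw [coe_sphereProj (hU z)]
  rfl

lemma isRegularOnSphere_of_contDiffAt {F : R3 → ℂ} (hF : ∀ x : S2, ContDiffAt ℝ ∞ F x) :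
    IsRegularOnSphere fun x => F x := fun x =>
  ContMDiffAt.comp (I' := 𝓘(ℝ, R3)) x (hF x).contMDiffAt (contMDiff_coe_sphere (n := 2) x)

/-- Trades the manifold structure for calculus in `ℝ³ ∖ {0}`; the closure properties of regular
functions follow from it. -/
lemma isRegularOnSphere_iff {f : S2 → ℂ} :
    IsRegularOnSphere f ↔ ∀ y : R3, y ≠ 0 → ContDiffAt ℝ ∞ (radialExtension f) y := by
  refine ⟨fun h y hy => h.contDiffAt_radialExtension hy, fun h => ?_⟩
  convert isRegularOnSphere_of_contDiffAt fun x => h x x.coe_ne_zero with x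
  rw [radialExtension_coe]

lemma IsRegularOnSphere.continuous {f : S2 → ℂ} (hf : IsRegularOnSphere f) : Continuous f :=
  ContMDiff.continuous hf

/-! ### The Euclidean and the spherical Laplacian -/

lemma laplacian_eq_sum_fderiv {ι : Type*} [Fintype ι] (v : OrthonormalBasis ι ℝ R3) (F : R3 → ℂ)
    (y : R3) :
    Laplacian.laplacian F y = ∑ i, fderiv ℝ (fderiv ℝ F) y (v i) (v i) := by
  rw [InnerProductSpace.laplacian_eq_iteratedFDeriv_orthonormalBasis F v]
  simp [iteratedFDeriv_two_apply]

lemma ContDiffAt.laplacian {F : R3 → ℂ} {y : R3} (hF : ContDiffAt ℝ ∞ F y) :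
    ContDiffAt ℝ ∞ (Laplacian.laplacian F) y := by
  have : Laplacian.laplacian F = fun y => ∑ i, fderiv ℝ (fderiv ℝ F) y
      (EuclideanSpace.basisFun (Fin 3) ℝ i) (EuclideanSpace.basisFun (Fin 3) ℝ i) :=
    funext fun y => laplacian_eq_sum_fderiv _ F y
  rw [this]
  refine ContDiffAt.sum fun i _ => ?_
  exact ((hF.fderiv_right (m := ∞) (by simp)).fderiv_right (m := ∞) (by simp)).clm_apply
    contDiffAt_const |>.clm_apply contDiffAt_const

lemma IsRegularOnSphere.sphereLaplacian {f : S2 → ℂ} (hf : IsRegularOnSphere f) :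
    IsRegularOnSphere (sphereLaplacian f) :=
  isRegularOnSphere_of_contDiffAt fun x =>
    (hf.contDiffAt_radialExtension x.coe_ne_zero).laplacian

lemma IsRegularOnSphere.iterate_sphereLaplacian {f : S2 → ℂ} (hf : IsRegularOnSphere f) (k : ℕ) :
    IsRegularOnSphere (_root_.sphereLaplacian^[k] f) := by
  induction k with
  | zero => exact hf
  | succ k ih => rw [Function.iterate_succ_apply']; exact ih.sphereLaplacian

/-- The Laplacian commutes with linear isometries. -/
lemma laplacian_comp_linearIsometryEquiv (R : R3 ≃ₗᵢ[ℝ] R3) (F : R3 → ℂ) (y : R3) :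
    Laplacian.laplacian (F ∘ R) y = Laplacian.laplacian F (R y) := by
  rw [InnerProductSpace.laplacian_eq_iteratedFDeriv_orthonormalBasis (F ∘ R)
      (EuclideanSpace.basisFun (Fin 3) ℝ),
    InnerProductSpace.laplacian_eq_iteratedFDeriv_orthonormalBasis F
      ((EuclideanSpace.basisFun (Fin 3) ℝ).map R)]
  refine Finset.sum_congr rfl fun i _ => ?_
  have := R.toContinuousLinearEquiv.iteratedFDerivWithin_comp_right F uniqueDiffOn_univ
    (Set.mem_univ (R y)) 2
  simp only [Set.preimage_univ, iteratedFDerivWithin_univ] at this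
  have h2 := congrArg (fun T => T ![EuclideanSpace.basisFun (Fin 3) ℝ i,
    EuclideanSpace.basisFun (Fin 3) ℝ i]) this
  refine h2.trans ?_
  simp only [ContinuousMultilinearMap.compContinuousLinearMap_apply]
  congr 1
  ext j
  fin_cases j <;> rfl

lemma laplacian_comp_smul {c : ℝ} (hc : c ≠ 0) (F : R3 → ℂ) (y : R3) :
    Laplacian.laplacian (fun z => F (c • z)) y = (c : ℂ) ^ 2 * Laplacian.laplacian F (c • y) := by
  let R : R3 ≃L[ℝ] R3 := ContinuousLinearEquiv.smulLeft (Units.mk0 c hc)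
  rw [InnerProductSpace.laplacian_eq_iteratedFDeriv_orthonormalBasis _
      (EuclideanSpace.basisFun (Fin 3) ℝ),
    InnerProductSpace.laplacian_eq_iteratedFDeriv_orthonormalBasis F
      (EuclideanSpace.basisFun (Fin 3) ℝ), Finset.mul_sum]
  refine Finset.sum_congr rfl fun i _ => ?_
  have := R.iteratedFDerivWithin_comp_right F uniqueDiffOn_univ (Set.mem_univ (R y)) 2
  simp only [Set.preimage_univ, iteratedFDerivWithin_univ] at this
  have h2 := congrArg (fun T => T ![EuclideanSpace.basisFun (Fin 3) ℝ i,
    EuclideanSpace.basisFun (Fin 3) ℝ i]) this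
  refine h2.trans ?_
  simp only [ContinuousMultilinearMap.compContinuousLinearMap_apply]
  have h3 := (iteratedFDeriv ℝ 2 F (R y)).map_smul_univ (fun _ => c)
    ![EuclideanSpace.basisFun (Fin 3) ℝ i, EuclideanSpace.basisFun (Fin 3) ℝ i]
  simp only [Finset.prod_const, Finset.card_univ, Fintype.card_fin, Complex.real_smul] at h3
  push_cast at h3
  convert! h3 using 2

/-- The extension is homogeneous of degree 0, so its Laplacian has degree -2; the factor `‖y‖²`
restores degree 0. -/
lemma radialExtension_sphereLaplacian (f : S2 → ℂ) {y : R3} (hy : y ≠ 0) :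
    radialExtension (sphereLaplacian f) y =
      (‖y‖ : ℂ) ^ 2 * Laplacian.laplacian (radialExtension f) y := by
  have hn : 0 < ‖y‖⁻¹ := inv_pos.mpr (norm_pos_iff.mpr hy)
  rw [radialExtension_of_ne _ hy, sphereLaplacian, coe_sphereProj hy]
  have h : (fun z => radialExtension f (‖y‖⁻¹ • z)) = radialExtension f :=
    funext fun z => radialExtension_smul f hn z
  have h2 := laplacian_comp_smul hn.ne' (radialExtension f) y
  rw [h] at h2
  rw [h2, ← mul_assoc, ← mul_pow]
  push_cast
  rw [mul_inv_cancel₀ (by simpa using hy), one_pow, one_mul]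

lemma radialExtension_add (f g : S2 → ℂ) :
    radialExtension (fun x => f x + g x) = radialExtension f + radialExtension g := by
  funext y
  by_cases hy : y = 0 <;> simp [radialExtension, hy]

lemma radialExtension_const_mul (c : ℂ) (f : S2 → ℂ) :
    radialExtension (fun x => c * f x) = c • radialExtension f := by
  funext y
  by_cases hy : y = 0 <;> simp [radialExtension, hy]

lemma radialExtension_conj (f : S2 → ℂ) :
    radialExtension (fun x => starRingEnd ℂ (f x)) = Complex.conjCLE ∘ radialExtension f := by
  funext y
  by_cases hy : y = 0 <;> simp [radialExtension, hy]

lemma IsRegularOnSphere.add {f g : S2 → ℂ} (hf : IsRegularOnSphere f)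
    (hg : IsRegularOnSphere g) : IsRegularOnSphere fun x => f x + g x := by
  rw [isRegularOnSphere_iff] at *
  intro y hy
  rw [radialExtension_add]
  exact (hf y hy).add (hg y hy)

lemma IsRegularOnSphere.const_mul {f : S2 → ℂ} (hf : IsRegularOnSphere f) (c : ℂ) :
    IsRegularOnSphere fun x => c * f x := by
  rw [isRegularOnSphere_iff] at *
  intro y hy
  rw [radialExtension_const_mul]
  exact (hf y hy).const_smul c

lemma isRegularOnSphere_const (c : ℂ) : IsRegularOnSphere fun _ => c :=
  isRegularOnSphere_of_contDiffAt (F := fun _ => c) fun _ => contDiffAt_const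

lemma IsRegularOnSphere.sum {ι : Type*} {s : Finset ι} {f : ι → S2 → ℂ}
    (hf : ∀ i ∈ s, IsRegularOnSphere (f i)) : IsRegularOnSphere fun x => ∑ i ∈ s, f i x := by
  classical
  induction s using Finset.induction_on with
  | empty => simpa using isRegularOnSphere_const 0
  | insert i s hi ih =>
    simp only [Finset.sum_insert hi]
    exact (hf i (by simp)).add (ih fun j hj => hf j (by simp [hj]))

lemma IsRegularOnSphere.conj {f : S2 → ℂ} (hf : IsRegularOnSphere f) :
    IsRegularOnSphere fun x => starRingEnd ℂ (f x) := by
  rw [isRegularOnSphere_iff] at *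
  intro y hy
  rw [radialExtension_conj]
  exact Complex.conjCLE.contDiff.contDiffAt.comp y (hf y hy)

lemma IsRegularOnSphere.contDiffAt_two {f : S2 → ℂ} (hf : IsRegularOnSphere f) (x : S2) :
    ContDiffAt ℝ 2 (radialExtension f) (x : R3) :=
  (hf.contDiffAt_radialExtension x.coe_ne_zero).of_le ENat.LEInfty.out

lemma sphereLaplacian_add {f g : S2 → ℂ} (hf : IsRegularOnSphere f) (hg : IsRegularOnSphere g) :
    sphereLaplacian (fun x => f x + g x) =
      fun x => sphereLaplacian f x + sphereLaplacian g x := by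
  funext x
  simp only [sphereLaplacian, radialExtension_add]
  exact (hf.contDiffAt_two x).laplacian_add (hg.contDiffAt_two x)

lemma sphereLaplacian_const_mul {f : S2 → ℂ} (hf : IsRegularOnSphere f) (c : ℂ) :
    sphereLaplacian (fun x => c * f x) = fun x => c * sphereLaplacian f x := by
  funext x
  simp only [sphereLaplacian, radialExtension_const_mul]
  exact InnerProductSpace.laplacian_smul c (hf.contDiffAt_two x)

lemma sphereLaplacian_conj {f : S2 → ℂ} (hf : IsRegularOnSphere f) :
    sphereLaplacian (fun x => starRingEnd ℂ (f x)) =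
      fun x => starRingEnd ℂ (sphereLaplacian f x) := by
  funext x
  simp only [sphereLaplacian, radialExtension_conj]
  exact (hf.contDiffAt_two x).laplacian_CLM_comp_left (l := Complex.conjCLE.toContinuousLinearMap)

lemma sphereLaplacian_sum {ι : Type*} {s : Finset ι} {f : ι → S2 → ℂ}
    (hf : ∀ i ∈ s, IsRegularOnSphere (f i)) :
    sphereLaplacian (fun x => ∑ i ∈ s, f i x) = fun x => ∑ i ∈ s, sphereLaplacian (f i) x := by
  classical
  induction s using Finset.induction_on with
  | empty =>
    have := sphereLaplacian_const_mul (isRegularOnSphere_const 0) 0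
    simpa using this
  | insert i s hi ih =>
    simp only [Finset.sum_insert hi]
    rw [sphereLaplacian_add (hf i (by simp)) (.sum fun j hj => hf j (by simp [hj])),
      ih fun j hj => hf j (by simp [hj])]

/-! ### Invariance under linear isometries -/

/-- The action of a linear isometry on the sphere. -/
noncomputable def S2.map (R : R3 ≃ₗᵢ[ℝ] R3) (x : S2) : S2 :=
  ⟨R x, by rw [mem_sphere_zero_iff_norm, R.norm_map, x.norm_coe]⟩

lemma S2.continuous_map (R : R3 ≃ₗᵢ[ℝ] R3) : Continuous (S2.map R) :=
  (R.continuous.comp continuous_subtype_val).subtype_mk _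

lemma sphereProj_isometry (R : R3 ≃ₗᵢ[ℝ] R3) {y : R3} (hy : y ≠ 0) :
    sphereProj (R y) = S2.map R (sphereProj y) := by
  ext1
  have h : (S2.map R (sphereProj y) : R3) = R (sphereProj y) := rfl
  rw [coe_sphereProj (by simpa using hy), h, coe_sphereProj hy, R.norm_map, map_smul]

lemma radialExtension_comp_map (R : R3 ≃ₗᵢ[ℝ] R3) (f : S2 → ℂ) :
    radialExtension (f ∘ S2.map R) = radialExtension f ∘ R := by
  funext y
  by_cases hy : y = 0
  · simp [hy, radialExtension]
  · rw [Function.comp_apply, radialExtension_of_ne _ hy,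
      radialExtension_of_ne _ (by simpa using hy), sphereProj_isometry R hy]
    rfl

lemma IsRegularOnSphere.comp_map {f : S2 → ℂ} (hf : IsRegularOnSphere f) (R : R3 ≃ₗᵢ[ℝ] R3) :
    IsRegularOnSphere (f ∘ S2.map R) := by
  rw [isRegularOnSphere_iff] at *
  intro y hy
  rw [radialExtension_comp_map]
  exact (hf (R y) (by simpa using hy)).comp y R.contDiff.contDiffAt

lemma sphereLaplacian_comp_map (R : R3 ≃ₗᵢ[ℝ] R3) (f : S2 → ℂ) :
    sphereLaplacian (f ∘ S2.map R) = sphereLaplacian f ∘ S2.map R := by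
  funext x
  rw [sphereLaplacian, radialExtension_comp_map, laplacian_comp_linearIsometryEquiv]
  rfl

/-! ### Product rule, radial and homogeneous functions -/

lemma fderiv_fderiv_apply {F : R3 → ℂ} {y : R3} (hF : ContDiffAt ℝ 2 F y) (v w : R3) :
    fderiv ℝ (fderiv ℝ F) y v w = fderiv ℝ (fun z => fderiv ℝ F z w) y v := by
  have h : DifferentiableAt ℝ (fderiv ℝ F) y :=
    (hF.fderiv_right (m := 1) (by norm_num)).differentiableAt (by norm_num)
  rw [fderiv_clm_apply h (differentiableAt_const w)]
  simp

/-- The standard basis of `ℝ³`. -/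
noncomputable abbrev stdBasisR3 : OrthonormalBasis (Fin 3) ℝ R3 := EuclideanSpace.basisFun (Fin 3) ℝ

lemma laplacian_eq_sum {F : R3 → ℂ} {y : R3} (hF : ContDiffAt ℝ 2 F y) :
    Laplacian.laplacian F y =
      ∑ i, fderiv ℝ (fun z => fderiv ℝ F z (stdBasisR3 i)) y (stdBasisR3 i) := by
  rw [laplacian_eq_sum_fderiv stdBasisR3]
  exact Finset.sum_congr rfl fun i _ => fderiv_fderiv_apply hF _ _

lemma laplacian_mul {F G : R3 → ℂ} {y : R3} (hF : ContDiffAt ℝ 2 F y) (hG : ContDiffAt ℝ 2 G y) :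
    Laplacian.laplacian (fun z => F z * G z) y =
      F y * Laplacian.laplacian G y + G y * Laplacian.laplacian F y +
        2 * ∑ i, fderiv ℝ F y (stdBasisR3 i) * fderiv ℝ G y (stdBasisR3 i) := by
  rw [laplacian_eq_sum (hF.mul hG), laplacian_eq_sum hF, laplacian_eq_sum hG, Finset.mul_sum,
    Finset.mul_sum, Finset.mul_sum, ← Finset.sum_add_distrib, ← Finset.sum_add_distrib]
  refine Finset.sum_congr rfl fun i _ => ?_
  set e := stdBasisR3 i
  have hd {H : R3 → ℂ} (hH : ContDiffAt ℝ 2 H y) : ∀ᶠ z in nhds y, DifferentiableAt ℝ H z := by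
    filter_upwards [hH.eventually (by simp)] with z hz using hz.differentiableAt (by norm_num)
  have hdd {H : R3 → ℂ} (hH : ContDiffAt ℝ 2 H y) :
      DifferentiableAt ℝ (fun z => fderiv ℝ H z e) y :=
    ((hH.fderiv_right (m := 1) (by norm_num)).differentiableAt (by norm_num)).clm_apply
      (differentiableAt_const e)
  have h1 : (fun z => fderiv ℝ (fun z => F z * G z) z e) =ᶠ[nhds y]
      fun z => F z * fderiv ℝ G z e + G z * fderiv ℝ F z e := by
    filter_upwards [hd hF, hd hG] with z hz hz'
    rw [fderiv_fun_mul hz hz']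
    simp
  have hF0 := (hd hF).self_of_nhds
  have hG0 := (hd hG).self_of_nhds
  rw [h1.fderiv_eq, fderiv_fun_add (hF0.fun_mul (hdd hG)) (hG0.fun_mul (hdd hF)),
    fderiv_fun_mul hF0 (hdd hG), fderiv_fun_mul hG0 (hdd hF)]
  simp only [add_apply, smul_apply, smul_eq_mul]
  ring

lemma hasFDerivAt_radial {g : ℝ → ℝ} {g' : ℝ} {y : R3} (hg : HasDerivAt g g' (‖y‖ ^ 2)) :
    HasFDerivAt (fun z : R3 => ((g (‖z‖ ^ 2) : ℝ) : ℂ))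
      (Complex.ofRealCLM.comp ((2 * g') • innerSL ℝ y)) y := by
  have h := hg.comp_hasFDerivAt y (hasStrictFDerivAt_norm_sq y).hasFDerivAt
  convert! Complex.ofRealCLM.hasFDerivAt.comp y h using 2
  ext v
  simp
  ring

lemma sum_inner_mul_clm (y : R3) (T : R3 →L[ℝ] ℂ) :
    ∑ i, ((inner ℝ y (stdBasisR3 i) : ℝ) : ℂ) * T (stdBasisR3 i) = T y := by
  conv_rhs => rw [← stdBasisR3.sum_repr' y, map_sum]
  refine Finset.sum_congr rfl fun i _ => ?_
  rw [map_smul, Complex.real_smul, real_inner_comm]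

/-- The gradient of a radial function points along `y`, so the cross term of `laplacian_mul` with a
radial factor is a derivative in the direction of `y`, which Euler's identity evaluates on
homogeneous functions. -/
lemma sum_fderiv_radial_mul {g : ℝ → ℝ} {g' : ℝ} {y : R3} (hg : HasDerivAt g g' (‖y‖ ^ 2))
    (T : R3 →L[ℝ] ℂ) :
    ∑ i, fderiv ℝ (fun z : R3 => ((g (‖z‖ ^ 2) : ℝ) : ℂ)) y (stdBasisR3 i) * T (stdBasisR3 i) =
      2 * g' * T y := by
  rw [(hasFDerivAt_radial hg).fderiv, ← sum_inner_mul_clm y T, Finset.mul_sum]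
  refine Finset.sum_congr rfl fun i _ => ?_
  simp
  ring

lemma fderiv_apply_self_of_homogeneous {F : R3 → ℂ} {y : R3} {d : ℕ}
    (hF : DifferentiableAt ℝ F y) (h : ∀ c : ℝ, 0 < c → F (c • y) = (c : ℂ) ^ d * F y) :
    fderiv ℝ F y y = d * F y := by
  have h1 : HasDerivAt (fun c : ℝ => F (c • y)) (fderiv ℝ F y y) 1 := by
    have h2 : HasDerivAt (fun c : ℝ => c • y) y 1 := by
      simpa using (hasDerivAt_id (1 : ℝ)).smul_const y
    refine HasFDerivAt.comp_hasDerivAt (1 : ℝ) ?_ h2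
    rw [one_smul]
    exact hF.hasFDerivAt
  have h3 : HasDerivAt (fun c : ℝ => (c : ℂ) ^ d * F y) (d * F y) 1 := by
    simpa using ((Complex.ofRealCLM.hasDerivAt (x := (1 : ℝ))).pow d).mul_const (F y)
  refine h1.unique (h3.congr_of_eventuallyEq ?_)
  filter_upwards [lt_mem_nhds (zero_lt_one' ℝ)] with c hc using h c hc

lemma laplacian_rpow_norm_sq (p : ℝ) (x : S2) :
    Laplacian.laplacian (fun z : R3 => (((‖z‖ ^ 2) ^ p : ℝ) : ℂ)) (x : R3) = 4 * p ^ 2 + 2 * p := by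
  have hpos {z : R3} (hz : z ≠ 0) : ‖z‖ ^ 2 ≠ 0 := by simpa using hz
  have hd (q : ℝ) {z : R3} (hz : z ≠ 0) :
      HasDerivAt (fun s : ℝ => s ^ q) (q * (‖z‖ ^ 2) ^ (q - 1)) (‖z‖ ^ 2) :=
    Real.hasDerivAt_rpow_const (Or.inl (hpos hz))
  have hsm : ContDiffAt ℝ 2 (fun z : R3 => (((‖z‖ ^ 2) ^ p : ℝ) : ℂ)) (x : R3) :=
    Complex.ofRealCLM.contDiff.contDiffAt.comp _
      (((contDiff_norm_sq ℝ).contDiffAt).rpow_const_of_ne (hpos x.coe_ne_zero))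
  rw [laplacian_eq_sum hsm]
  have key (i : Fin 3) :
      fderiv ℝ (fun z => fderiv ℝ (fun z : R3 => (((‖z‖ ^ 2) ^ p : ℝ) : ℂ)) z (stdBasisR3 i)) x
        (stdBasisR3 i) = 4 * p * (p - 1) * (inner ℝ (x : R3) (stdBasisR3 i) : ℝ) ^ 2 + 2 * p := by
    set e := stdBasisR3 i
    have h1 : (fun z => fderiv ℝ (fun z : R3 => (((‖z‖ ^ 2) ^ p : ℝ) : ℂ)) z e) =ᶠ[nhds (x : R3)]
        fun z => (((‖z‖ ^ 2) ^ (p - 1) : ℝ) : ℂ) * (2 * p * (inner ℝ e z : ℝ)) := by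
      filter_upwards [isOpen_ne.mem_nhds x.coe_ne_zero] with z hz
      rw [(hasFDerivAt_radial (hd p hz)).fderiv]
      simp [real_inner_comm]
      ring
    have h2 : HasFDerivAt (fun z : R3 => (2 * p * (inner ℝ e z : ℝ) : ℂ))
        ((2 * p : ℂ) • Complex.ofRealCLM.comp (innerSL ℝ e)) x :=
      ((Complex.ofRealCLM.comp (innerSL ℝ e)).hasFDerivAt).const_mul (2 * p : ℂ)
    rw [h1.fderiv_eq, ((hasFDerivAt_radial (hd (p - 1) x.coe_ne_zero)).fun_mul h2).fderiv]
    have he : inner ℝ e e = (1 : ℝ) := by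
      rw [real_inner_self_eq_norm_sq, stdBasisR3.norm_eq_one, one_pow]
    simp only [add_apply, smul_apply, smul_eq_mul,
      ContinuousLinearMap.comp_apply, innerSL_apply_apply, Complex.ofRealCLM_apply, he, x.norm_coe,
      one_pow, Real.one_rpow, real_inner_comm (x : R3) e]
    push_cast
    ring
  rw [Finset.sum_congr rfl fun i _ => key i, Finset.sum_add_distrib, ← Finset.mul_sum]
  have h3 : ∑ i, ((inner ℝ (x : R3) (stdBasisR3 i) : ℝ) : ℂ) ^ 2 = 1 := by
    have := sum_inner_mul_clm (x : R3) (Complex.ofRealCLM.comp (innerSL ℝ (x : R3)))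
    simpa [pow_two, x.norm_coe] using this
  rw [h3]
  simp
  ring

/-- The spherical Laplacian of the restriction of a homogeneous function. -/
lemma sphereLaplacian_of_homogeneous {F : R3 → ℂ} (hF : ContDiff ℝ ∞ F) (d : ℕ)
    (h : ∀ c : ℝ, 0 < c → ∀ y, F (c • y) = (c : ℂ) ^ d * F y) (x : S2) :
    sphereLaplacian (fun x => F x) x = Laplacian.laplacian F x - d * (d + 1) * F x := by
  -- The factor `(‖z‖²)^p = ‖z‖^{-d}` turns `F` into a function of degree 0, that is, the radial
  -- extension of its restriction.
  set p : ℝ := -(d / 2) with hp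
  have h1 : radialExtension (fun x => F x) =ᶠ[nhds (x : R3)]
      fun z => (((‖z‖ ^ 2) ^ p : ℝ) : ℂ) * F z := by
    filter_upwards [isOpen_ne.mem_nhds x.coe_ne_zero] with z hz
    have hz' : 0 < ‖z‖ := norm_pos_iff.mpr hz
    rw [radialExtension_of_ne _ hz, coe_sphereProj hz, h _ (inv_pos.mpr hz')]
    congr 1
    rw [← Complex.ofReal_pow]
    congr 1
    rw [← Real.rpow_natCast ‖z‖ 2, ← Real.rpow_mul hz'.le, hp, inv_pow, ← Real.rpow_natCast,
      ← Real.rpow_neg hz'.le]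
    congr 1
    push_cast
    ring
  have hsm : ContDiffAt ℝ 2 (fun z : R3 => (((‖z‖ ^ 2) ^ p : ℝ) : ℂ)) (x : R3) :=
    Complex.ofRealCLM.contDiff.contDiffAt.comp _
      (((contDiff_norm_sq ℝ).contDiffAt).rpow_const_of_ne (by simp [x.norm_coe]))
  have hF2 : ContDiffAt ℝ 2 F x := hF.contDiffAt.of_le ENat.LEInfty.out
  rw [sphereLaplacian, (InnerProductSpace.laplacian_congr_nhds h1).self_of_nhds,
    laplacian_mul hsm hF2, laplacian_rpow_norm_sq,
    sum_fderiv_radial_mul (Real.hasDerivAt_rpow_const (Or.inl (by simp [x.norm_coe]))),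
    fderiv_apply_self_of_homogeneous (hF2.differentiableAt (by norm_num)) fun c hc => h c hc x]
  simp [x.norm_coe, hp]
  ring

/-! ### Functions `(x₀ + s x₁)^m q(x₂)` and their Laplacian -/

lemma hasFDerivAt_polynomial_clm (T : R3 →L[ℝ] ℂ) (p : ℂ[X]) (y : R3) :
    HasFDerivAt (fun z => p.eval (T z)) (p.derivative.eval (T y) • T) y := by
  have h := ((p.hasDerivAt (T y)).hasFDerivAt.restrictScalars ℝ).comp y T.hasFDerivAt
  convert! h using 1
  ext v
  simp [mul_comm]

lemma contDiff_polynomial_clm (T : R3 →L[ℝ] ℂ) (p : ℂ[X]) {n : WithTop ℕ∞} :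
    ContDiff ℝ n (fun z => p.eval (T z)) := by
  have : ContDiff ℝ n (fun w : ℂ => p.eval w) := by
    simpa [Polynomial.aeval_def] using (p.contDiff_aeval n (𝕜 := ℂ)).restrict_scalars ℝ
  exact this.comp T.contDiff

lemma laplacian_polynomial_clm (T : R3 →L[ℝ] ℂ) (p : ℂ[X]) (y : R3) :
    Laplacian.laplacian (fun z => p.eval (T z)) y =
      p.derivative.derivative.eval (T y) * ∑ i, T (stdBasisR3 i) ^ 2 := by
  rw [laplacian_eq_sum (contDiff_polynomial_clm T p).contDiffAt, Finset.mul_sum]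
  refine Finset.sum_congr rfl fun i _ => ?_
  have h1 : (fun z => fderiv ℝ (fun z => p.eval (T z)) z (stdBasisR3 i)) =
      fun z => p.derivative.eval (T z) * T (stdBasisR3 i) := by
    funext z
    rw [(hasFDerivAt_polynomial_clm T p z).fderiv]
    simp
  rw [h1, ((hasFDerivAt_polynomial_clm T p.derivative y).mul_const _).fderiv]
  simp
  ring

/-- The linear form `x₂` on `ℝ³`, with complex values. -/
noncomputable def zForm : R3 →L[ℝ] ℂ := Complex.ofRealCLM.comp (EuclideanSpace.proj 2)

/-- The linear form `x₀ + s x₁` on `ℝ³`. -/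
noncomputable def wForm (s : ℂ) : R3 →L[ℝ] ℂ :=
  Complex.ofRealCLM.comp (EuclideanSpace.proj 0) +
    s • Complex.ofRealCLM.comp (EuclideanSpace.proj 1)

lemma zForm_apply (x : R3) : zForm x = (x 2 : ℂ) := rfl

lemma wForm_apply (s : ℂ) (x : R3) : wForm s x = (x 0 : ℂ) + s * (x 1 : ℂ) := rfl

lemma sum_wForm_sq {s : ℂ} (hs : s ^ 2 = -1) : ∑ i, wForm s (stdBasisR3 i) ^ 2 = 0 := by
  simp [Fin.sum_univ_three, wForm_apply, hs]

lemma sum_zForm_sq : ∑ i, zForm (stdBasisR3 i) ^ 2 = 1 := by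
  simp [Fin.sum_univ_three, zForm_apply]

lemma sum_wForm_mul_zForm (s : ℂ) : ∑ i, wForm s (stdBasisR3 i) * zForm (stdBasisR3 i) = 0 := by
  simp [Fin.sum_univ_three, wForm_apply, zForm_apply]

lemma S2.sum_sq (x : S2) : (x : R3) 0 ^ 2 + (x : R3) 1 ^ 2 + (x : R3) 2 ^ 2 = 1 := by
  have := x.norm_coe
  rw [EuclideanSpace.norm_eq, Real.sqrt_eq_one, Fin.sum_univ_three] at this
  simpa using this

lemma wForm_mul_wForm_neg {s : ℂ} (hs : s ^ 2 = -1) (x : S2) :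
    wForm s x * wForm (-s) x = 1 - zForm x ^ 2 := by
  have := congrArg (fun t : ℝ => (t : ℂ)) x.sum_sq
  push_cast at this
  rw [wForm_apply, wForm_apply, zForm_apply]
  linear_combination this - (((x : R3) 1 : ℝ) : ℂ) ^ 2 * hs

/-- The function `(x₀ + s x₁)^m q(x₂)` on the sphere. -/
noncomputable def sectorial (s : ℂ) (m : ℕ) (q : ℂ[X]) (x : S2) : ℂ :=
  wForm s x ^ m * q.eval (zForm x)

lemma isRegularOnSphere_sectorial (s : ℂ) (m : ℕ) (q : ℂ[X]) :
    IsRegularOnSphere (sectorial s m q) :=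
  isRegularOnSphere_of_contDiffAt (F := fun y => wForm s y ^ m * q.eval (zForm y)) fun _ =>
    (((wForm s).contDiff.pow m).mul (contDiff_polynomial_clm zForm q)).contDiffAt

lemma sectorial_add (s : ℂ) (m : ℕ) (p q : ℂ[X]) :
    sectorial s m (p + q) = fun x => sectorial s m p x + sectorial s m q x := by
  funext x
  simp [sectorial, mul_add]

lemma sectorial_C_mul (s : ℂ) (m : ℕ) (c : ℂ) (q : ℂ[X]) :
    sectorial s m (Polynomial.C c * q) = fun x => c * sectorial s m q x := by
  funext x
  simp [sectorial]
  ring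

-- The form `x₀ + s x₁` is isotropic when `s² = -1` and orthogonal to `x₂`, so in the Laplacian of
-- `(x₀ + s x₁)^m x₂^k` only the second derivative in `x₂` survives. Homogeneity of degree `m + k`
-- gives the other term.
open Polynomial in
lemma sphereLaplacian_sectorial_X_pow {s : ℂ} (hs : s ^ 2 = -1) (m k : ℕ) (x : S2) :
    sphereLaplacian (sectorial s m (X ^ k)) x = sectorial s m
      (derivative (derivative (X ^ k)) - C ((m + k) * (m + k + 1) : ℂ) * X ^ k) x := by
  have h1 := sphereLaplacian_of_homogeneous
    (F := fun y => (X ^ m : ℂ[X]).eval (wForm s y) * (X ^ k : ℂ[X]).eval (zForm y))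
    ((contDiff_polynomial_clm _ _).mul (contDiff_polynomial_clm _ _)) (m + k)
    (fun c _ y => by simp [mul_pow, pow_add]; ring) x
  have h2 : sectorial s m (X ^ k) =
      fun x : S2 => (X ^ m : ℂ[X]).eval (wForm s x) * (X ^ k : ℂ[X]).eval (zForm x) := by
    funext x
    simp [sectorial]
  rw [h2, h1, laplacian_mul (contDiff_polynomial_clm _ _).contDiffAt
    (contDiff_polynomial_clm _ _).contDiffAt, laplacian_polynomial_clm, laplacian_polynomial_clm,
    sum_wForm_sq hs, sum_zForm_sq, (hasFDerivAt_polynomial_clm _ _ _).fderiv,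
    (hasFDerivAt_polynomial_clm _ _ _).fderiv]
  have h3 (a b : ℂ) : ∑ i, (a • wForm s) (stdBasisR3 i) * (b • zForm) (stdBasisR3 i) = 0 := by
    have : ∀ i, (a • wForm s) (stdBasisR3 i) * (b • zForm) (stdBasisR3 i) =
        a * b * (wForm s (stdBasisR3 i) * zForm (stdBasisR3 i)) := fun i => by
      simp only [smul_apply, smul_eq_mul]; ring
    simp_rw [this, ← Finset.mul_sum, sum_wForm_mul_zForm, mul_zero]
  rw [h3]
  simp only [sectorial, eval_sub, eval_mul, eval_C, eval_pow, eval_X]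
  push_cast
  ring

open Polynomial in
lemma sphereLaplacian_sectorial {s : ℂ} (hs : s ^ 2 = -1) (m : ℕ) (q : ℂ[X]) :
    sphereLaplacian (sectorial s m q) = sectorial s m
      ((1 - X ^ 2) * derivative (derivative q) - C (2 * (m + 1) : ℂ) * (X * derivative q) -
        C (m * (m + 1) : ℂ) * q) := by
  induction q using Polynomial.induction_on' with
  | add p q hp hq =>
    rw [sectorial_add, sphereLaplacian_add (isRegularOnSphere_sectorial s m p)
      (isRegularOnSphere_sectorial s m q), hp, hq, ← sectorial_add]
    congr 1
    simp only [derivative_add]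
    ring
  | monomial k a =>
    rw [← C_mul_X_pow_eq_monomial, sectorial_C_mul,
      sphereLaplacian_const_mul (isRegularOnSphere_sectorial s m _)]
    funext x
    rw [sphereLaplacian_sectorial_X_pow hs]
    simp only [sectorial, eval_sub, eval_mul, eval_C, eval_pow, eval_X, derivative_C_mul, eval_one]
    -- On `z^k` the operator collects `k(k-1) + 2(m+1)k + m(m+1) = (m+k)(m+k+1)`; this is how a
    -- formula depending on `k` becomes a differential operator linear in `q`.
    have hX : ((1 - zForm x ^ 2) * eval (zForm x) (derivative (derivative (X ^ k : ℂ[X]))) -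
        2 * (m + 1) * (zForm x * eval (zForm x) (derivative (X ^ k : ℂ[X]))) -
        m * (m + 1) * zForm x ^ k) = eval (zForm x) (derivative (derivative (X ^ k : ℂ[X]))) -
        (m + k) * (m + k + 1) * zForm x ^ k := by
      rcases k with _ | _ | k
      · simp
      · simp; ring
      · simp; ring
    linear_combination -(a * wForm s x ^ m) * hX

/-! ### Legendre's differential equation -/

open Polynomial in
/-- The differential equation of the derivatives of `(X² - 1)^l`. -/
lemma iterate_derivative_X_sq_sub_one (l n : ℕ) :
    (X ^ 2 - 1) * derivative^[n + 2] ((X ^ 2 - 1 : ℝ[X]) ^ l) +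
      C (2 * (n + 1 - l) : ℝ) * X * derivative^[n + 1] ((X ^ 2 - 1 : ℝ[X]) ^ l) +
      C ((n + 1) * (n - 2 * l) : ℝ) * derivative^[n] ((X ^ 2 - 1 : ℝ[X]) ^ l) = 0 := by
  induction n with
  | zero =>
    -- The first-order equation satisfied by `(X² - 1)^l`; differentiating it once gives the case `n
    -- = 0`, and each further differentiation raises `n` by one.
    have h : (X ^ 2 - 1) * derivative ((X ^ 2 - 1 : ℝ[X]) ^ l) =
        C (2 * l : ℝ) * X * (X ^ 2 - 1) ^ l := by
      rcases l with _ | l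
      · simp
      · simp [derivative_pow]; ring
    have h2 := congrArg derivative h
    simp only [derivative_mul, derivative_sub, derivative_X_pow, derivative_one, derivative_X,
      derivative_C] at h2
    simp only [Function.iterate_succ, Function.iterate_zero, Function.comp_apply, id]
    simp only [map_mul, map_sub, map_add, C_1] at h2 ⊢
    simp at h2 ⊢
    linear_combination h2
  | succ n ih =>
    have h2 := congrArg derivative ih
    simp only [derivative_add, derivative_mul, derivative_sub, derivative_X_pow, derivative_one,
      derivative_X, derivative_C, ← Function.iterate_succ_apply' (⇑(derivative (R := ℝ)))] at h2
    have hC : (C 2 : ℝ[X]) = 2 := map_ofNat C 2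
    simp only [map_mul, map_sub, map_add, C_1, hC] at h2 ⊢
    simp [hC] at h2 ⊢
    linear_combination h2

/-- The `m`-th derivative of the Legendre polynomial `P_l`, with complex coefficients. -/
noncomputable def legendreDeriv (l m : ℕ) : ℂ[X] :=
  (Polynomial.derivative^[m] (legendrePoly l)).map Complex.ofRealHom

open Polynomial in
lemma iterate_derivative_legendrePoly (l m : ℕ) :
    derivative^[m] (legendrePoly l) =
      C (1 / (2 ^ l * (l.factorial : ℝ))) * derivative^[l + m] ((X ^ 2 - 1) ^ l) := by
  rw [legendrePoly, iterate_derivative_C_mul, ← Function.iterate_add_apply, add_comm]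

-- The preceding equation at `n = l + m`, where `(n+1)(n-2l) = m(m+1) - l(l+1)`.
open Polynomial in
lemma legendreDeriv_ode (l m : ℕ) :
    (1 - X ^ 2) * derivative (derivative (legendreDeriv l m)) -
      C (2 * (m + 1) : ℂ) * (X * derivative (legendreDeriv l m)) -
      C (m * (m + 1) : ℂ) * legendreDeriv l m = C (sphereEigenvalue l) * legendreDeriv l m := by
  have h := congrArg (fun p => (C (1 / (2 ^ l * (l.factorial : ℝ))) * p).map Complex.ofRealHom)
    (iterate_derivative_X_sq_sub_one l (l + m))
  simp only [legendreDeriv, derivative_map, iterate_derivative_legendrePoly, derivative_C_mul,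
    ← Function.iterate_succ_apply' (⇑(derivative (R := ℝ)))] at h ⊢
  simp only [mul_zero, Polynomial.map_zero, Polynomial.map_mul, Polynomial.map_add,
    Polynomial.map_sub, map_C, map_X, Polynomial.map_pow, Polynomial.map_one] at h ⊢
  simp only [sphereEigenvalue, map_mul, map_sub, map_add, map_neg, map_one, map_natCast,
    map_ofNat, Nat.cast_add] at h ⊢
  linear_combination -h

lemma sphereLaplacian_sectorial_legendreDeriv {s : ℂ} (hs : s ^ 2 = -1) (l m : ℕ) :
    sphereLaplacian (sectorial s m (legendreDeriv l m)) =
      fun x => sphereEigenvalue l * sectorial s m (legendreDeriv l m) x := by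
  rw [sphereLaplacian_sectorial hs, legendreDeriv_ode, sectorial_C_mul]

open Polynomial in
lemma degree_iterate_derivative {p : ℂ[X]} {n k : ℕ} (hp : p.degree = (n + k : ℕ)) :
    (derivative^[k] p).degree = n := by
  induction k generalizing n with
  | zero => simpa using hp
  | succ k ih =>
    have h : (derivative^[k] p).degree = (n + 1 : ℕ) := ih (by rw [hp]; congr 1; ring)
    rw [Function.iterate_succ_apply', degree_derivative (by
      rw [natDegree_eq_of_degree_eq_some h]; omega), natDegree_eq_of_degree_eq_some h]
    simp

open Polynomial in
lemma degree_legendreDeriv (n m : ℕ) : (legendreDeriv (n + m) m).degree = n := by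
  rw [legendreDeriv, iterate_derivative_legendrePoly, Polynomial.map_mul, map_C, degree_C_mul (by
    simp [Nat.factorial_ne_zero]), ← iterate_derivative_map]
  refine degree_iterate_derivative ?_
  have : (X ^ 2 - 1 : ℂ[X]).degree = 2 := by
    rw [← C_1, degree_X_pow_sub_C (by norm_num)]
    rfl
  simp only [Polynomial.map_pow, Polynomial.map_sub, map_X, Polynomial.map_one, degree_pow, this]
  simp
  norm_cast
  ring

/-- The `m`-th derivative of `P_{n+m}` has degree exactly `n`, so the family has one member in each
degree. -/
lemma span_legendreDeriv (m : ℕ) :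
    Submodule.span ℂ (Set.range fun n => legendreDeriv (n + m) m) = ⊤ := by
  let S : Polynomial.Sequence ℂ := ⟨fun n => legendreDeriv (n + m) m, fun n =>
    degree_legendreDeriv n m⟩
  exact S.span fun n => (Polynomial.leadingCoeff_ne_zero.mpr (S.ne_zero n)).isUnit

/-! ### Spherical harmonics as eigenfunctions -/

/-- The imaginary unit with the sign of `m`. -/
noncomputable def signI (m : ℤ) : ℂ := if 0 ≤ m then Complex.I else -Complex.I

lemma signI_sq (m : ℤ) : signI m ^ 2 = -1 := by
  unfold signI
  split_ifs <;> simp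

/-- The constant factor of the spherical harmonic `Y_l^m`. -/
noncomputable def harmonicConst (l : ℕ) (m : ℤ) : ℂ :=
  (Real.sqrt ((2 * (l : ℝ) + 1) / (4 * Real.pi) *
      ((((l : ℤ) - m).toNat.factorial : ℝ) / (((l : ℤ) + m).toNat.factorial : ℝ))) : ℂ) *
    (if 0 ≤ m then (-1) ^ m.natAbs
      else (((l - m.natAbs).factorial : ℂ) / ((l + m.natAbs).factorial : ℂ)))

lemma harmonicConst_ne_zero (l : ℕ) (m : ℤ) : harmonicConst l m ≠ 0 := by
  refine mul_ne_zero ?_ ?_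
  · rw [Complex.ofReal_ne_zero]
    exact (Real.sqrt_pos.mpr (by positivity)).ne'
  · split_ifs
    · simp
    · simp [Nat.factorial_ne_zero]

/-- The polar form of `x₀ ± i x₁`, whose modulus is `sin θ`. It holds at the poles too, where the
modulus is 0 and the value of the argument is immaterial. -/
lemma wForm_signI_pow (m : ℤ) (x : S2) :
    wForm (signI m) x ^ m.natAbs = ((Real.sqrt (1 - (x : R3) 2 ^ 2) ^ m.natAbs : ℝ) : ℂ) *
      Complex.exp (Complex.I * (m : ℂ) * (Complex.arg ⟨(x : R3) 0, (x : R3) 1⟩ : ℂ)) := by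
  set w : ℂ := ⟨(x : R3) 0, (x : R3) 1⟩ with hw
  have hn : ‖w‖ = Real.sqrt (1 - (x : R3) 2 ^ 2) := by
    have h1 : 1 - (x : R3) 2 ^ 2 = (x : R3) 0 ^ 2 + (x : R3) 1 ^ 2 := by linarith [x.sum_sq]
    rw [h1, Complex.norm_def, Complex.normSq_apply]
    congr 1
    simp [hw]
    ring
  have hp : w = (‖w‖ : ℂ) * Complex.exp (w.arg * Complex.I) := (Complex.norm_mul_exp_arg_mul_I w).symm
  have hI : wForm Complex.I x = w := by
    apply Complex.ext <;> simp [wForm_apply, hw]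
  have hI' : wForm (-Complex.I) x = starRingEnd ℂ w := by
    apply Complex.ext <;> simp [wForm_apply, hw]
  rw [← hn, Complex.ofReal_pow, signI]
  split_ifs with h
  · obtain ⟨k, rfl⟩ := Int.eq_ofNat_of_zero_le h
    rw [hI, Int.natAbs_natCast]
    conv_lhs => rw [hp]
    rw [mul_pow, ← Complex.exp_nat_mul]
    congr 2
    push_cast
    ring
  · obtain ⟨k, hk⟩ := Int.eq_ofNat_of_zero_le (by omega : 0 ≤ -m)
    obtain rfl : m = -k := by omega
    rw [hI', Int.natAbs_neg, Int.natAbs_natCast]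
    conv_lhs => rw [hp]
    rw [map_mul, ← Complex.exp_conj, mul_pow, ← Complex.exp_nat_mul]
    simp only [map_mul, Complex.conj_ofReal, Complex.conj_I]
    congr 2
    push_cast
    ring

lemma sphericalHarmonic_eq_sectorial (l : ℕ) (m : ℤ) :
    sphericalHarmonic l m = fun x => harmonicConst l m *
      sectorial (signI m) m.natAbs (legendreDeriv l m.natAbs) x := by
  funext x
  have he : (legendreDeriv l m.natAbs).eval (zForm x) =
      (((Polynomial.derivative^[m.natAbs] (legendrePoly l)).eval ((x : R3) 2) : ℝ) : ℂ) := by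
    rw [legendreDeriv, zForm_apply]
    exact Polynomial.eval_map_apply Complex.ofRealHom _
  rw [sectorial, wForm_signI_pow, he, sphericalHarmonic, harmonicConst, assocLegendre,
    assocLegendreNat]
  -- For `m < 0` the sign in `P_l^{-|m|}` cancels the one inside `P_l^{|m|}`, which is why
  -- `harmonicConst` has no sign there.
  have h1 : ((-1 : ℂ) ^ m.natAbs) * (-1) ^ m.natAbs = 1 := by
    rw [← mul_pow]; simp
  split_ifs with h
  · push_cast
    ring
  · push_cast
    linear_combination (norm := ring_nf) (Real.sqrt ((2 * (l : ℝ) + 1) / (4 * Real.pi) *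
      ((((l : ℤ) - m).toNat.factorial : ℝ) / (((l : ℤ) + m).toNat.factorial : ℝ))) : ℂ) *
      (((l - m.natAbs).factorial : ℂ) / ((l + m.natAbs).factorial : ℂ)) *
      (Real.sqrt (1 - (x : R3) 2 ^ 2) : ℂ) ^ m.natAbs *
      Complex.exp (Complex.I * (m : ℂ) * (Complex.arg ⟨(x : R3) 0, (x : R3) 1⟩ : ℂ)) *
      (((Polynomial.derivative^[m.natAbs] (legendrePoly l)).eval ((x : R3) 2) : ℝ) : ℂ) * h1

lemma isRegularOnSphere_sphericalHarmonic (l : ℕ) (m : ℤ) :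
    IsRegularOnSphere (sphericalHarmonic l m) := by
  rw [sphericalHarmonic_eq_sectorial]
  exact (isRegularOnSphere_sectorial _ _ _).const_mul _

lemma sphereLaplacian_sphericalHarmonic (l : ℕ) (m : ℤ) :
    sphereLaplacian (sphericalHarmonic l m) =
      fun x => sphereEigenvalue l * sphericalHarmonic l m x := by
  rw [sphericalHarmonic_eq_sectorial, sphereLaplacian_const_mul (isRegularOnSphere_sectorial _ _ _),
    sphereLaplacian_sectorial_legendreDeriv (signI_sq m)]
  funext x
  ring

/-! ### Cutoffs and Green's identity -/

/-- A smooth bump function on the line around `1`. -/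
noncomputable def bumpOne : ContDiffBump (1 : ℝ) := ⟨1 / 4, 1 / 2, by norm_num, by norm_num⟩

/-- A smooth radial cutoff function on `ℝ³`, supported in a shell around the sphere. -/
noncomputable def shellCutoff (y : R3) : ℝ := bumpOne (‖y‖ ^ 2)

lemma contDiff_shellCutoff {n : ℕ∞} : ContDiff ℝ n shellCutoff :=
  bumpOne.contDiff.comp (contDiff_norm_sq ℝ)

lemma shellCutoff_pos {y : R3} (h : |‖y‖ ^ 2 - 1| < 1 / 2) : 0 < shellCutoff y :=
  bumpOne.pos_of_mem_ball (by rwa [Metric.mem_ball, Real.dist_eq])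

lemma shellCutoff_eq_zero {y : R3} (h : 1 / 2 ≤ |‖y‖ ^ 2 - 1|) : shellCutoff y = 0 :=
  bumpOne.zero_of_le_dist (by simpa [Real.dist_eq, bumpOne] using h)

lemma shellCutoff_isometry (R : R3 ≃ₗᵢ[ℝ] R3) (y : R3) : shellCutoff (R y) = shellCutoff y := by
  simp [shellCutoff]

lemma shellCutoff_eventually_zero : ∀ᶠ y in nhds (0 : R3), shellCutoff y = 0 := by
  have hc : Continuous fun y : R3 => ‖y‖ ^ 2 := by fun_prop
  have : ∀ᶠ y in nhds (0 : R3), ‖y‖ ^ 2 < 1 / 2 :=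
    hc.continuousAt.eventually_lt_const (by simp)
  filter_upwards [this] with y hy
  refine shellCutoff_eq_zero ?_
  rw [abs_sub_comm]
  exact le_trans (by linarith) (le_abs_self _)

lemma hasCompactSupport_shellCutoff : HasCompactSupport shellCutoff := by
  refine HasCompactSupport.of_support_subset_isCompact (isCompact_closedBall (0 : R3) 2) ?_
  intro y hy
  by_contra h
  refine hy (shellCutoff_eq_zero ?_)
  have h2 : 2 < ‖y‖ := by simpa using h
  refine le_trans ?_ (le_abs_self _)
  nlinarith

/-- The radial extension of a function, cut off away from the sphere. -/
noncomputable def cutoffExtension (f : S2 → ℂ) (y : R3) : ℂ :=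
  (shellCutoff y : ℂ) * radialExtension f y

lemma contDiff_ofReal_shellCutoff {n : ℕ∞} : ContDiff ℝ n fun y => (shellCutoff y : ℂ) :=
  Complex.ofRealCLM.contDiff.comp contDiff_shellCutoff

lemma contDiff_cutoffExtension {f : S2 → ℂ} (hf : IsRegularOnSphere f) :
    ContDiff ℝ ∞ (cutoffExtension f) := by
  rw [contDiff_iff_contDiffAt]
  intro y
  rcases eq_or_ne y 0 with rfl | hy
  · refine (contDiffAt_const (c := (0 : ℂ))).congr_of_eventuallyEq ?_
    filter_upwards [shellCutoff_eventually_zero] with z hz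
    simp [cutoffExtension, hz]
  · exact (contDiff_ofReal_shellCutoff (n := ⊤)).contDiffAt.mul (hf.contDiffAt_radialExtension hy)

lemma hasCompactSupport_cutoffExtension (f : S2 → ℂ) : HasCompactSupport (cutoffExtension f) := by
  refine hasCompactSupport_shellCutoff.mono fun y hy => ?_
  contrapose! hy
  simp_all [cutoffExtension]

/-- The cross term vanishes: the gradient of the cutoff is radial, and the extension is constant
along rays. -/
lemma laplacian_cutoffExtension {f : S2 → ℂ} (hf : IsRegularOnSphere f) {y : R3} (hy : y ≠ 0) :
    Laplacian.laplacian (cutoffExtension f) y =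
      shellCutoff y * Laplacian.laplacian (radialExtension f) y +
        radialExtension f y * Laplacian.laplacian (fun y => (shellCutoff y : ℂ)) y := by
  have hf2 : ContDiffAt ℝ 2 (radialExtension f) y :=
    (hf.contDiffAt_radialExtension hy).of_le ENat.LEInfty.out
  have h := laplacian_mul (contDiff_ofReal_shellCutoff (n := 2)).contDiffAt hf2
  refine h.trans ?_
  have hb : HasDerivAt bumpOne (deriv bumpOne (‖y‖ ^ 2)) (‖y‖ ^ 2) :=
    ((bumpOne.contDiff (n := 1)).differentiable (by norm_num) _).hasDerivAt
  have h0 : fderiv ℝ (radialExtension f) y y = 0 := by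
    rw [fderiv_apply_self_of_homogeneous (d := 0) (hf2.differentiableAt (by norm_num)) fun c hc => by
      rw [radialExtension_smul f hc]; simp]
    simp
  have h2 := sum_fderiv_radial_mul hb (fderiv ℝ (radialExtension f) y)
  rw [h0, mul_zero] at h2
  simp only [shellCutoff]
  rw [h2]
  simp

/-- Green's second identity for compactly supported functions. -/
lemma integral_laplacian_mul {F G : R3 → ℂ} (hF : ContDiff ℝ 2 F) (hG : ContDiff ℝ 2 G)
    (hFc : HasCompactSupport F) (hGc : HasCompactSupport G) :
    ∫ y, Laplacian.laplacian F y * G y = ∫ y, F y * Laplacian.laplacian G y := by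
  have hd {H : R3 → ℂ} (hH : ContDiff ℝ 2 H) (v : R3) : ContDiff ℝ 1 fun y => fderiv ℝ H y v :=
    (hH.fderiv_right (m := 1) (by norm_num)).clm_apply contDiff_const
  have hdd {H : R3 → ℂ} (hH : ContDiff ℝ 1 H) (v : R3) : Continuous fun y => fderiv ℝ H y v :=
    (hH.continuous_fderiv (by norm_num)).clm_apply continuous_const
  have hcs {H : R3 → ℂ} (hH : HasCompactSupport H) (v : R3) :
      HasCompactSupport fun y => fderiv ℝ H y v := hH.fderiv_apply (𝕜 := ℝ) v
  have hint {H K : R3 → ℂ} (hH : Continuous H) (hK : Continuous K) (hs : HasCompactSupport H) :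
      Integrable fun y => H y * K y :=
    (hH.mul hK).integrable_of_hasCompactSupport hs.mul_right
  have key {F G : R3 → ℂ} (hF : ContDiff ℝ 2 F) (hG : ContDiff ℝ 2 G)
      (hFc : HasCompactSupport F) (hGc : HasCompactSupport G) (v : R3) :
      ∫ y, F y * fderiv ℝ (fun z => fderiv ℝ G z v) y v =
        -∫ y, fderiv ℝ F y v * fderiv ℝ G y v :=
    integral_mul_fderiv_eq_neg_fderiv_mul_of_integrable
      (hint (hd hF v).continuous (hd hG v).continuous (hcs hFc v))
      (hint hF.continuous (hdd (hd hG v) v) hFc)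
      (hint hF.continuous (hd hG v).continuous hFc)
      (fun y _ => hF.differentiable (by norm_num) y)
      (fun y _ => (hd hG v).differentiable (by norm_num) y)
  simp_rw [laplacian_eq_sum hF.contDiffAt, laplacian_eq_sum hG.contDiffAt, Finset.sum_mul,
    Finset.mul_sum]
  rw [integral_finsetSum _ fun i _ => hint (hdd (hd hF _) _) hG.continuous (hcs (hcs hFc _) _),
    integral_finsetSum _ fun i _ => hint hF.continuous (hdd (hd hG _) _) hFc]
  refine Finset.sum_congr rfl fun i _ => ?_
  rw [key hF hG hFc hGc]
  have h := key hG hF hGc hFc (stdBasisR3 i)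
  simp_rw [mul_comm (G _), mul_comm (fderiv ℝ G _ _)] at h
  exact h

/-! ### The invariant measure and symmetry of the Laplacian -/

/-- The radial weight defining the measure of the sphere. -/
noncomputable def shellWeight (y : R3) : ℝ := (shellCutoff y / ‖y‖) ^ 2

lemma shellWeight_nonneg (y : R3) : 0 ≤ shellWeight y := sq_nonneg _

lemma shellWeight_zero : shellWeight 0 = 0 := by simp [shellWeight]

lemma shellWeight_isometry (R : R3 ≃ₗᵢ[ℝ] R3) (y : R3) : shellWeight (R y) = shellWeight y := by
  simp [shellWeight, shellCutoff_isometry]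

lemma continuous_shellWeight : Continuous shellWeight := by
  rw [continuous_iff_continuousAt]
  intro y
  rcases eq_or_ne y 0 with rfl | hy
  · refine (continuousAt_const (y := (0 : ℝ))).congr ?_
    filter_upwards [shellCutoff_eventually_zero] with z hz
    simp [shellWeight, hz]
  · exact (((contDiff_shellCutoff (n := 0)).continuous.continuousAt).div
      continuous_norm.continuousAt (norm_ne_zero_iff.mpr hy)).pow 2

lemma hasCompactSupport_shellWeight : HasCompactSupport shellWeight := by
  refine hasCompactSupport_shellCutoff.mono fun y hy => ?_
  contrapose! hy
  simp_all [shellWeight]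

lemma continuousAt_sphereProj {y : R3} (hy : y ≠ 0) : ContinuousAt sphereProj y := by
  rw [Topology.IsInducing.subtypeVal.continuousAt_iff]
  refine ContinuousAt.congr (f := fun z => ‖z‖⁻¹ • z) ?_ ?_
  · exact (continuous_norm.continuousAt.inv₀ (norm_ne_zero_iff.mpr hy)).smul continuousAt_id
  · filter_upwards [isOpen_ne.mem_nhds hy] with z hz using (coe_sphereProj hz).symm

lemma measurable_sphereProj : Measurable sphereProj := by
  refine measurable_of_continuousOn_compl_singleton 0 fun y hy => ?_
  exact (continuousAt_sphereProj hy).continuousWithinAt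

/-- A rotation invariant measure on the sphere. -/
noncomputable def sphereMeasure : Measure S2 :=
  (volume.withDensity fun y => ENNReal.ofReal (shellWeight y)).map sphereProj

lemma measurable_ofReal_shellWeight : Measurable fun y => ENNReal.ofReal (shellWeight y) :=
  continuous_shellWeight.measurable.ennreal_ofReal

instance isFiniteMeasure_sphereMeasure : IsFiniteMeasure sphereMeasure := by
  have : IsFiniteMeasure (volume.withDensity fun y => ENNReal.ofReal (shellWeight y)) :=
    isFiniteMeasure_withDensity_ofReal
      (continuous_shellWeight.integrable_of_hasCompactSupport hasCompactSupport_shellWeight).2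
  unfold sphereMeasure
  infer_instance

/-- The weight is positive near the sphere. This makes the Hermitian form definite on continuous
functions. -/
instance isOpenPosMeasure_sphereMeasure : sphereMeasure.IsOpenPosMeasure := by
  refine ⟨fun U hU ⟨x, hx⟩ h => ?_⟩
  rw [sphereMeasure, Measure.map_apply measurable_sphereProj hU.measurableSet,
    withDensity_apply_eq_zero measurable_ofReal_shellWeight] at h
  have hn : {y : R3 | ENNReal.ofReal (shellWeight y) ≠ 0} ∩ sphereProj ⁻¹' U ∈ nhds (x : R3) := by
    have h1 : sphereProj ⁻¹' U ∈ nhds (x : R3) :=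
      (continuousAt_sphereProj x.coe_ne_zero) (by rw [sphereProj_coe]; exact hU.mem_nhds hx)
    have h2 : 0 < shellWeight x := by
      have : 0 < shellCutoff x := shellCutoff_pos (by simp [x.norm_coe])
      rw [shellWeight, x.norm_coe]
      positivity
    filter_upwards [h1, continuous_shellWeight.continuousAt.eventually_const_lt h2] with y hy hy2
    exact ⟨by simpa using hy2, hy⟩
  exact (Measure.measure_pos_of_mem_nhds volume hn).ne' h

lemma integral_sphereMeasure {f : S2 → ℂ} (hf : Continuous f) :
    ∫ x, f x ∂sphereMeasure = ∫ y, (shellWeight y : ℂ) * radialExtension f y := by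
  rw [sphereMeasure, integral_map measurable_sphereProj.aemeasurable hf.aestronglyMeasurable,
    integral_withDensity_eq_integral_toReal_smul measurable_ofReal_shellWeight (by simp)]
  refine integral_congr_ae (Filter.Eventually.of_forall fun y => ?_)
  rcases eq_or_ne y 0 with rfl | hy
  · simp [shellWeight_zero]
  · simp only [radialExtension_of_ne f hy, ENNReal.toReal_ofReal (shellWeight_nonneg y),
      Complex.real_smul]

lemma integral_comp_map (R : R3 ≃ₗᵢ[ℝ] R3) {f : S2 → ℂ} (hf : Continuous f) :
    ∫ x, f (S2.map R x) ∂sphereMeasure = ∫ x, f x ∂sphereMeasure := by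
  rw [integral_sphereMeasure hf, integral_sphereMeasure (f := fun x => f (S2.map R x))
    (hf.comp (S2.continuous_map R))]
  have h := R.measurePreserving.integral_comp' (f := R.toHomeomorph.toMeasurableEquiv)
    fun y => (shellWeight y : ℂ) * radialExtension f y
  rw [← h]
  refine integral_congr_ae (Filter.Eventually.of_forall fun y => ?_)
  have h2 := congrFun (radialExtension_comp_map R f) y
  change _ = (shellWeight (R y) : ℂ) * radialExtension f (R y)
  rw [shellWeight_isometry]
  simp only [Function.comp_def] at h2
  simp only [h2]

lemma integrable_sphere {f : S2 → ℂ} (hf : Continuous f) : Integrable f sphereMeasure :=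
  hf.integrable_of_hasCompactSupport (HasCompactSupport.of_compactSpace f)

/-- The Laplacian of the sphere is symmetric. -/
lemma integral_sphereLaplacian_mul {f g : S2 → ℂ} (hf : IsRegularOnSphere f)
    (hg : IsRegularOnSphere g) :
    ∫ x, sphereLaplacian f x * g x ∂sphereMeasure =
      ∫ x, f x * sphereLaplacian g x ∂sphereMeasure := by
  have hle : (2 : WithTop ℕ∞) ≤ ∞ := ENat.LEInfty.out
  have hF := (contDiff_cutoffExtension hf).of_le hle
  have hG := (contDiff_cutoffExtension hg).of_le hle
  have hFc := hasCompactSupport_cutoffExtension f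
  have hGc := hasCompactSupport_cutoffExtension g
  have hgreen := integral_laplacian_mul hF hG hFc hGc
  have hcl {u : S2 → ℂ} (hu : IsRegularOnSphere u) :
      Continuous (Laplacian.laplacian (cutoffExtension u)) :=
    continuous_iff_continuousAt.mpr fun y =>
      (contDiff_cutoffExtension hu).contDiffAt.laplacian.continuousAt
  have hi1 : Integrable fun y => Laplacian.laplacian (cutoffExtension f) y * cutoffExtension g y :=
    ((hcl hf).mul hG.continuous).integrable_of_hasCompactSupport hGc.mul_left
  have hi2 : Integrable fun y => cutoffExtension f y * Laplacian.laplacian (cutoffExtension g) y :=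
    (hF.continuous.mul (hcl hg)).integrable_of_hasCompactSupport hFc.mul_right
  have hLf := hf.sphereLaplacian
  have hLg := hg.sphereLaplacian
  rw [← sub_eq_zero, ← integral_sub hi1 hi2] at hgreen
  rw [← sub_eq_zero, ← integral_sub (integrable_sphere (hLf.continuous.fun_mul hg.continuous))
    (integrable_sphere (hf.continuous.fun_mul hLg.continuous)), integral_sphereMeasure
    ((hLf.continuous.fun_mul hg.continuous).fun_sub (hf.continuous.fun_mul hLg.continuous)), ← hgreen]
  -- The two integrands agree pointwise. The terms with the Laplacian of the cutoff cancel by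
  -- antisymmetry, and the denominator `‖y‖²` of the weight absorbs the factor from
  -- `radialExtension_sphereLaplacian`.
  refine integral_congr_ae (Filter.Eventually.of_forall fun y => ?_)
  rcases eq_or_ne y 0 with rfl | hy
  · simp [shellWeight_zero, cutoffExtension, radialExtension]
  · have hsub : radialExtension (fun x => sphereLaplacian f x * g x - f x * sphereLaplacian g x) y =
        radialExtension (sphereLaplacian f) y * radialExtension g y -
          radialExtension f y * radialExtension (sphereLaplacian g) y := by
      simp [radialExtension, hy]
    have hn : (‖y‖ : ℂ) ≠ 0 := by simpa using hy
    simp only [hsub, radialExtension_sphereLaplacian _ hy, laplacian_cutoffExtension hf hy,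
      laplacian_cutoffExtension hg hy, cutoffExtension, shellWeight]
    push_cast
    field_simp
    ring

/-! ### Density of the spherical harmonics -/

/-- The continuous function `(x₀ + s x₁)^m q(x₂)` on the sphere, depending linearly on `q`. -/
noncomputable def sectorialC (s : ℂ) (m : ℕ) : ℂ[X] →ₗ[ℂ] C(S2, ℂ) where
  toFun q := ⟨sectorial s m q, (isRegularOnSphere_sectorial s m q).continuous⟩
  map_add' p q := by
    ext x
    simp [sectorial, mul_add]
  map_smul' c q := by
    ext x
    simp [sectorial]
    ring

lemma sectorialC_apply (s : ℂ) (m : ℕ) (q : ℂ[X]) (x : S2) :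
    sectorialC s m q x = wForm s x ^ m * q.eval (zForm x) := rfl

/-- The spherical harmonic `Y_l^m` as a continuous function. -/
noncomputable def harmonicC (l : ℕ) (m : ℤ) : C(S2, ℂ) :=
  ⟨sphericalHarmonic l m, (isRegularOnSphere_sphericalHarmonic l m).continuous⟩

/-- The linear span of the spherical harmonics. -/
noncomputable def harmonicSpan : Submodule ℂ C(S2, ℂ) :=
  Submodule.span ℂ {f | ∃ l : ℕ, ∃ m ∈ Finset.Icc (-(l : ℤ)) l, f = harmonicC l m}

lemma sectorialC_mem_harmonicSpan {s : ℂ} (hs : s = Complex.I ∨ s = -Complex.I) (m : ℕ)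
    (q : ℂ[X]) : sectorialC s m q ∈ harmonicSpan := by
  -- The order `m'` is `±m` with the sign of `s`; for `m = 0` both signs give the same function, and
  -- `m' = 0` serves.
  have hm : ∃ m' : ℤ, m'.natAbs = m ∧ wForm (signI m') ^ m = (wForm s : R3 → ℂ) ^ m := by
    rcases Nat.eq_zero_or_pos m with rfl | hm
    · exact ⟨0, by simp⟩
    · rcases hs with rfl | rfl
      · exact ⟨m, by simp [signI]⟩
      · exact ⟨-m, by simp [signI, hm.ne']⟩
  obtain ⟨m', rfl, hw⟩ := hm
  suffices h : Submodule.span ℂ (Set.range fun n => legendreDeriv (n + m'.natAbs) m'.natAbs) ≤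
      harmonicSpan.comap (sectorialC s m'.natAbs) by
    rw [span_legendreDeriv] at h
    exact h Submodule.mem_top
  rw [Submodule.span_le]
  rintro _ ⟨n, rfl⟩
  set l := n + m'.natAbs with hl
  have h : sectorialC s m'.natAbs (legendreDeriv l m'.natAbs) =
      (harmonicConst l m')⁻¹ • harmonicC l m' := by
    ext x
    have h1 := congrFun hw (x : R3)
    have h2 : harmonicC l m' x = harmonicConst l m' *
      sectorial (signI m') m'.natAbs (legendreDeriv l m'.natAbs) x :=
      congrFun (sphericalHarmonic_eq_sectorial l m') x
    simp only [Pi.pow_apply] at h1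
    rw [ContinuousMap.smul_apply, h2, smul_eq_mul,
      inv_mul_cancel_left₀ (harmonicConst_ne_zero l m'), sectorial, h1]
    rfl
  change sectorialC s m'.natAbs (legendreDeriv l m'.natAbs) ∈ harmonicSpan
  rw [h]
  exact Submodule.smul_mem _ _ (Submodule.subset_span ⟨l, m', by
    rw [Finset.mem_Icc]; omega, rfl⟩)

/-- The linear span of the functions `(x₀ ± i x₁)^m q(x₂)`. -/
noncomputable def sectorialSpan : Submodule ℂ C(S2, ℂ) :=
  Submodule.span ℂ {f | ∃ s : ℂ, (s = Complex.I ∨ s = -Complex.I) ∧ ∃ m q, f = sectorialC s m q}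

lemma sectorialC_mem_sectorialSpan {s : ℂ} (hs : s = Complex.I ∨ s = -Complex.I) (m : ℕ)
    (q : ℂ[X]) : sectorialC s m q ∈ sectorialSpan :=
  Submodule.subset_span ⟨s, hs, m, q, rfl⟩

lemma sectorialSpan_le_harmonicSpan : sectorialSpan ≤ harmonicSpan := by
  refine Submodule.span_le.mpr ?_
  rintro _ ⟨s, hs, m, q, rfl⟩
  exact sectorialC_mem_harmonicSpan hs m q

lemma mul_mem_sectorialSpan_of {g : C(S2, ℂ)}
    (h : ∀ s : ℂ, (s = Complex.I ∨ s = -Complex.I) → ∀ m q, g * sectorialC s m q ∈ sectorialSpan)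
    {f : C(S2, ℂ)} (hf : f ∈ sectorialSpan) : g * f ∈ sectorialSpan := by
  have : sectorialSpan ≤ sectorialSpan.comap (LinearMap.mulLeft ℂ g) := by
    refine Submodule.span_le.mpr ?_
    rintro _ ⟨s, hs, m, q, rfl⟩
    exact h s hs m q
  exact this hf

open Polynomial in
lemma zForm_mul_mem_sectorialSpan {f : C(S2, ℂ)} (hf : f ∈ sectorialSpan) :
    sectorialC Complex.I 0 X * f ∈ sectorialSpan := by
  refine mul_mem_sectorialSpan_of (fun s hs m q => ?_) hf
  convert! sectorialC_mem_sectorialSpan hs m (X * q) using 1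
  ext x
  simp [sectorialC_apply]
  ring

-- A factor with the same sign raises the power; one with the opposite sign lowers it, because `(x₀
-- + i x₁)(x₀ - i x₁) = 1 - x₂²` on the sphere.
open Polynomial in
lemma wForm_mul_mem_sectorialSpan {t : ℂ} (ht : t = Complex.I ∨ t = -Complex.I) {f : C(S2, ℂ)}
    (hf : f ∈ sectorialSpan) : sectorialC t 1 1 * f ∈ sectorialSpan := by
  refine mul_mem_sectorialSpan_of (fun s hs m q => ?_) hf
  by_cases hst : s = t
  · subst hst
    convert! sectorialC_mem_sectorialSpan hs (m + 1) q using 1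
    ext x
    simp [sectorialC_apply]
    ring
  have hst' : t = -s := by
    rcases hs with rfl | rfl <;> rcases ht with rfl | rfl <;> simp_all
  have hs2 : s ^ 2 = -1 := by rcases hs with rfl | rfl <;> simp
  rcases m with _ | m
  · convert! sectorialC_mem_sectorialSpan ht 1 q using 1
    ext x
    simp [sectorialC_apply]
  · convert! sectorialC_mem_sectorialSpan hs m ((1 - X ^ 2) * q) using 1
    ext x
    have := wForm_mul_wForm_neg hs2 x
    simp only [ContinuousMap.mul_apply, sectorialC_apply, hst', eval_mul, eval_sub, eval_one,
      eval_pow, eval_X]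
    linear_combination wForm s x ^ m * q.eval (zForm x) * this

/-- The star algebra of polynomial functions on the sphere. -/
noncomputable def spherePolynomials : StarSubalgebra ℂ C(S2, ℂ) :=
  StarAlgebra.adjoin ℂ {sectorialC Complex.I 1 1, sectorialC Complex.I 0 Polynomial.X}

lemma spherePolynomials_le {f : C(S2, ℂ)} (hf : f ∈ spherePolynomials) : f ∈ harmonicSpan := by
  have hf' : f ∈ Algebra.adjoin ℂ
      ({sectorialC Complex.I 1 1, sectorialC Complex.I 0 Polynomial.X} ∪
        star {sectorialC Complex.I 1 1, sectorialC Complex.I 0 Polynomial.X}) := hf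
  -- Induction on `f` as a multiplication operator makes the product case a composition; the claim
  -- follows by applying it to `g = 1`.
  have key : ∀ g ∈ sectorialSpan, f * g ∈ sectorialSpan := by
    induction hf' using Algebra.adjoin_induction with
    | mem a ha =>
      intro g hg
      have ha' : a = sectorialC Complex.I 1 1 ∨ a = sectorialC (-Complex.I) 1 1 ∨
          a = sectorialC Complex.I 0 Polynomial.X := by
        rcases ha with (rfl | rfl) | ha
        · simp
        · simp
        · have hw : star (sectorialC Complex.I 1 1) = sectorialC (-Complex.I) 1 1 := by
            ext x
            simp [sectorialC_apply, wForm_apply]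
          have hz : star (sectorialC Complex.I 0 Polynomial.X) =
              sectorialC Complex.I 0 Polynomial.X := by
            ext x
            simp [sectorialC_apply, zForm_apply]
          rcases ha with ha | ha
          · rw [← hw, ← ha]; simp
          · rw [← hz, ← Set.mem_singleton_iff.mp ha]; simp
      rcases ha' with rfl | rfl | rfl
      · exact wForm_mul_mem_sectorialSpan (Or.inl rfl) hg
      · exact wForm_mul_mem_sectorialSpan (Or.inr rfl) hg
      · exact zForm_mul_mem_sectorialSpan hg
    | algebraMap r =>
      intro g hg
      rw [← Algebra.smul_def]
      exact Submodule.smul_mem _ _ hg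
    | add a b _ _ ha hb =>
      intro g hg
      rw [add_mul]
      exact Submodule.add_mem _ (ha ‹_› g hg) (hb ‹_› g hg)
    | mul a b _ _ ha hb =>
      intro g hg
      rw [mul_assoc]
      exact ha ‹_› _ (hb ‹_› g hg)
  have h1 : (1 : C(S2, ℂ)) ∈ sectorialSpan := by
    convert! sectorialC_mem_sectorialSpan (Or.inl rfl) 0 1 using 1
    ext x
    simp [sectorialC_apply]
  simpa using sectorialSpan_le_harmonicSpan (key 1 h1)

lemma spherePolynomials_separatesPoints : spherePolynomials.SeparatesPoints := by
  intro x y hxy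
  by_contra! h
  have hmem (g : C(S2, ℂ)) (hg : g ∈ ({sectorialC Complex.I 1 1,
      sectorialC Complex.I 0 Polynomial.X} : Set C(S2, ℂ))) : g x = g y :=
    h g ⟨g, StarAlgebra.subset_adjoin ℂ _ hg, rfl⟩
  have h1 := hmem (sectorialC Complex.I 1 1) (by simp)
  have h2 := hmem (sectorialC Complex.I 0 Polynomial.X) (by simp)
  simp only [sectorialC_apply, wForm_apply, zForm_apply, Polynomial.eval_one, Polynomial.eval_X,
    pow_one, pow_zero, mul_one, one_mul, Complex.ofReal_inj] at h1 h2
  have hre := congrArg Complex.re h1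
  have him := congrArg Complex.im h1
  simp at hre him
  refine hxy (Subtype.ext (PiLp.ext fun i => ?_))
  fin_cases i
  · exact hre
  · exact him
  · exact h2

/-- Stone-Weierstrass for the coordinate functions, whose polynomials lie in the span of the
harmonics. -/
lemma dense_harmonicSpan : Dense (harmonicSpan : Set C(S2, ℂ)) := by
  have h := ContinuousMap.starSubalgebra_topologicalClosure_eq_top_of_separatesPoints
    spherePolynomials spherePolynomials_separatesPoints
  have hd : Dense (spherePolynomials : Set C(S2, ℂ)) := by
    rw [dense_iff_closure_eq, ← StarSubalgebra.topologicalClosure_coe, h]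
    rfl
  exact hd.mono fun f hf => spherePolynomials_le hf

/-! ### The Hermitian form and completeness -/

/-- The Hermitian form `∫ f ḡ` on functions on the sphere. -/
noncomputable def sphereInner (f g : S2 → ℂ) : ℂ :=
  ∫ x, f x * starRingEnd ℂ (g x) ∂sphereMeasure

lemma integrable_mul_conj {f g : S2 → ℂ} (hf : Continuous f) (hg : Continuous g) :
    Integrable (fun x => f x * starRingEnd ℂ (g x)) sphereMeasure :=
  integrable_sphere (hf.mul (Complex.continuous_conj.comp hg))

lemma sphereInner_const_mul_left (c : ℂ) (f g : S2 → ℂ) :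
    sphereInner (fun x => c * f x) g = c * sphereInner f g := by
  simp only [sphereInner, mul_assoc, integral_const_mul]

lemma sphereInner_conj (f g : S2 → ℂ) :
    starRingEnd ℂ (sphereInner f g) = sphereInner g f := by
  rw [sphereInner, ← integral_conj, sphereInner]
  simp [mul_comm]

lemma sphereInner_const_mul_right (c : ℂ) (f g : S2 → ℂ) :
    sphereInner f (fun x => c * g x) = starRingEnd ℂ c * sphereInner f g := by
  rw [← sphereInner_conj, sphereInner_const_mul_left, map_mul, sphereInner_conj]

lemma sphereInner_sum_left {ι : Type*} (s : Finset ι) {f : ι → S2 → ℂ} {g : S2 → ℂ}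
    (hf : ∀ i ∈ s, Continuous (f i)) (hg : Continuous g) :
    sphereInner (fun x => ∑ i ∈ s, f i x) g = ∑ i ∈ s, sphereInner (f i) g := by
  simp only [sphereInner, Finset.sum_mul]
  exact integral_finsetSum _ fun i hi => integrable_mul_conj (hf i hi) hg

lemma sphereInner_sum_right {ι : Type*} (s : Finset ι) {f : S2 → ℂ} {g : ι → S2 → ℂ}
    (hf : Continuous f) (hg : ∀ i ∈ s, Continuous (g i)) :
    sphereInner f (fun x => ∑ i ∈ s, g i x) = ∑ i ∈ s, sphereInner f (g i) := by
  rw [← sphereInner_conj, sphereInner_sum_left s hg hf, map_sum]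
  exact Finset.sum_congr rfl fun i _ => sphereInner_conj _ _

lemma sphereInner_sub_left {f g h : S2 → ℂ} (hf : Continuous f) (hg : Continuous g)
    (hh : Continuous h) :
    sphereInner (fun x => f x - g x) h = sphereInner f h - sphereInner g h := by
  simp only [sphereInner, sub_mul]
  exact integral_sub (integrable_mul_conj hf hh) (integrable_mul_conj hg hh)

/-- The square `∫ |f|²` of the norm of a function on the sphere. -/
noncomputable def sphereNormSq (f : S2 → ℂ) : ℝ := ∫ x, ‖f x‖ ^ 2 ∂sphereMeasure

lemma sphereInner_self (f : S2 → ℂ) : sphereInner f f = sphereNormSq f := by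
  rw [sphereInner, sphereNormSq, ← integral_complex_ofReal]
  simp [Complex.mul_conj, Complex.normSq_eq_norm_sq]

lemma sphereNormSq_pos {f : S2 → ℂ} (hf : Continuous f) (h : ∃ x, f x ≠ 0) :
    0 < sphereNormSq f := by
  obtain ⟨x, hx⟩ := h
  have hc : Continuous fun x => ‖f x‖ ^ 2 := hf.norm.pow 2
  exact hc.integral_pos_of_hasCompactSupport_nonneg_nonzero (HasCompactSupport.of_compactSpace _)
    (fun x => sq_nonneg _) (x := x) (by simpa using hx)

lemma eq_zero_of_sphereInner_self {f : S2 → ℂ} (hf : Continuous f) (h : sphereInner f f = 0) :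
    f = 0 := by
  by_contra hne
  have := sphereNormSq_pos hf (Function.ne_iff.mp hne)
  rw [sphereInner_self] at h
  exact this.ne' (by exact_mod_cast h)

lemma exists_norm_le_of_continuous {f : S2 → ℂ} (hf : Continuous f) :
    ∃ M, 0 ≤ M ∧ ∀ x, ‖f x‖ ≤ M := by
  obtain ⟨C, hC⟩ := (isCompact_range hf).isBounded.exists_norm_le
  exact ⟨C, (norm_nonneg _).trans (hC _ ⟨northPole, rfl⟩), fun x => hC _ ⟨x, rfl⟩⟩

/-- The Hermitian form as a continuous linear functional of its first argument. -/
lemma exists_clm_eq_sphereInner {f : S2 → ℂ} (hf : Continuous f) :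
    ∃ T : C(S2, ℂ) →L[ℂ] ℂ, ∀ g : C(S2, ℂ), T g = sphereInner g f := by
  let T : C(S2, ℂ) →ₗ[ℂ] ℂ :=
    { toFun := fun g => sphereInner g f
      map_add' := fun g k => by
        simp only [sphereInner, ContinuousMap.add_apply, add_mul]
        exact integral_add (integrable_mul_conj g.continuous hf)
          (integrable_mul_conj k.continuous hf)
      map_smul' := fun c g => sphereInner_const_mul_left c g f }
  obtain ⟨C, -, hC⟩ := exists_norm_le_of_continuous hf
  refine ⟨T.mkContinuous (C * sphereMeasure.real Set.univ) fun g => ?_, fun g => rfl⟩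
  have := norm_integral_le_of_norm_le_const (μ := sphereMeasure) (C := ‖g‖ * C)
    (f := fun x => g x * starRingEnd ℂ (f x)) (Filter.Eventually.of_forall fun x => by
      rw [norm_mul, RCLike.norm_conj]
      exact mul_le_mul (g.norm_coe_le_norm x) (hC _) (norm_nonneg _) (norm_nonneg _))
  exact this.trans (le_of_eq (by ring))

/-- Completeness of the spherical harmonics. -/
lemma eq_zero_of_forall_sphereInner_harmonic {f : S2 → ℂ} (hf : Continuous f)
    (h : ∀ l : ℕ, ∀ m ∈ Finset.Icc (-(l : ℤ)) l, sphereInner f (sphericalHarmonic l m) = 0) :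
    f = 0 := by
  obtain ⟨T, hT⟩ := exists_clm_eq_sphereInner hf
  have h0 : harmonicSpan ≤ LinearMap.ker T.toLinearMap := by
    refine Submodule.span_le.mpr ?_
    rintro _ ⟨l, m, hm, rfl⟩
    have h1 := congrArg (starRingEnd ℂ) (h l m hm)
    rw [sphereInner_conj, map_zero] at h1
    exact (hT _).trans h1
  have hall : (T : C(S2, ℂ) → ℂ) = fun _ => 0 :=
    T.continuous.ext_on dense_harmonicSpan continuous_const fun g hg => h0 hg
  exact eq_zero_of_sphereInner_self hf ((hT ⟨f, hf⟩).symm.trans (congrFun hall ⟨f, hf⟩))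

lemma continuous_sphericalHarmonic (l : ℕ) (m : ℤ) : Continuous (sphericalHarmonic l m) :=
  (isRegularOnSphere_sphericalHarmonic l m).continuous

/-! ### Eigenspaces and orthogonality -/

lemma conj_sphereEigenvalue (l : ℕ) :
    starRingEnd ℂ (sphereEigenvalue l) = sphereEigenvalue l := by
  simp [sphereEigenvalue]

lemma sphereEigenvalue_injective : Function.Injective sphereEigenvalue := by
  intro l k h
  have h1 : l * (l + 1) = k * (k + 1) := by
    simp only [sphereEigenvalue, neg_inj] at h
    exact_mod_cast h
  nlinarith [lt_trichotomy l k, h1]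

lemma sphereInner_sphereLaplacian {f g : S2 → ℂ} (hf : IsRegularOnSphere f)
    (hg : IsRegularOnSphere g) :
    sphereInner (sphereLaplacian f) g = sphereInner f (sphereLaplacian g) := by
  have h := integral_sphereLaplacian_mul hf hg.conj
  rw [sphereLaplacian_conj hg] at h
  exact h

lemma sphereInner_sphereLaplacian_harmonic {f : S2 → ℂ} (hf : IsRegularOnSphere f) (l : ℕ)
    (m : ℤ) : sphereInner (sphereLaplacian f) (sphericalHarmonic l m) =
      sphereEigenvalue l * sphereInner f (sphericalHarmonic l m) := by
  rw [sphereInner_sphereLaplacian hf (isRegularOnSphere_sphericalHarmonic l m),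
    sphereLaplacian_sphericalHarmonic, sphereInner_const_mul_right, conj_sphereEigenvalue]

/-- The eigenspace of the Laplacian of the sphere for the degree `l`. -/
structure IsHarmonicOfDegree (l : ℕ) (f : S2 → ℂ) : Prop where
  regular : IsRegularOnSphere f
  eigen : sphereLaplacian f = fun x => sphereEigenvalue l * f x

lemma isHarmonicOfDegree_sphericalHarmonic (l : ℕ) (m : ℤ) :
    IsHarmonicOfDegree l (sphericalHarmonic l m) :=
  ⟨isRegularOnSphere_sphericalHarmonic l m, sphereLaplacian_sphericalHarmonic l m⟩

lemma IsHarmonicOfDegree.const_mul {l : ℕ} {f : S2 → ℂ} (hf : IsHarmonicOfDegree l f) (c : ℂ) :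
    IsHarmonicOfDegree l fun x => c * f x := by
  refine ⟨hf.regular.const_mul c, ?_⟩
  rw [sphereLaplacian_const_mul hf.regular, hf.eigen]
  funext x
  ring

lemma IsHarmonicOfDegree.sum {l : ℕ} {ι : Type*} {s : Finset ι} {f : ι → S2 → ℂ}
    (hf : ∀ i ∈ s, IsHarmonicOfDegree l (f i)) : IsHarmonicOfDegree l fun x => ∑ i ∈ s, f i x := by
  refine ⟨.sum fun i hi => (hf i hi).regular, ?_⟩
  rw [sphereLaplacian_sum fun i hi => (hf i hi).regular]
  funext x
  rw [Finset.mul_sum]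
  exact Finset.sum_congr rfl fun i hi => by rw [(hf i hi).eigen]

lemma IsHarmonicOfDegree.sub {l : ℕ} {f g : S2 → ℂ} (hf : IsHarmonicOfDegree l f)
    (hg : IsHarmonicOfDegree l g) : IsHarmonicOfDegree l fun x => f x - g x := by
  have hg' := hg.const_mul (-1)
  have he : (fun x => f x - g x) = fun x => f x + -1 * g x := by
    funext x
    ring
  rw [he]
  refine ⟨hf.regular.add hg'.regular, ?_⟩
  rw [sphereLaplacian_add hf.regular hg'.regular, hf.eigen, hg'.eigen]
  funext x
  ring

lemma IsHarmonicOfDegree.comp_map {l : ℕ} {f : S2 → ℂ} (hf : IsHarmonicOfDegree l f)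
    (R : R3 ≃ₗᵢ[ℝ] R3) : IsHarmonicOfDegree l (f ∘ S2.map R) := by
  refine ⟨hf.regular.comp_map R, ?_⟩
  rw [sphereLaplacian_comp_map, hf.eigen]
  rfl

lemma IsHarmonicOfDegree.sphereInner_eq_zero {l k : ℕ} {f : S2 → ℂ}
    (hf : IsHarmonicOfDegree l f) (h : l ≠ k) (m : ℤ) :
    sphereInner f (sphericalHarmonic k m) = 0 := by
  have h1 := sphereInner_sphereLaplacian_harmonic hf.regular k m
  rw [hf.eigen, sphereInner_const_mul_left] at h1
  have h2 : sphereEigenvalue l - sphereEigenvalue k ≠ 0 :=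
    sub_ne_zero.mpr fun h' => h (sphereEigenvalue_injective h')
  exact (mul_eq_zero.mp (by linear_combination h1 :
    (sphereEigenvalue l - sphereEigenvalue k) * sphereInner f (sphericalHarmonic k m) = 0)).resolve_left
    h2

/-- The rotation by the angle `α` around the polar axis. -/
noncomputable def polarRotation (α : ℝ) : R3 ≃ₗᵢ[ℝ] R3 :=
  LinearIsometry.toLinearIsometryEquiv
    { toFun := fun x => !₂[Real.cos α * x 0 - Real.sin α * x 1,
        Real.sin α * x 0 + Real.cos α * x 1, x 2]
      map_add' := fun x y => by
        ext i
        fin_cases i <;> simp <;> ring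
      map_smul' := fun c x => by
        ext i
        fin_cases i <;> simp <;> ring
      norm_map' := fun x => by
        simp only [EuclideanSpace.norm_eq, Fin.sum_univ_three, LinearMap.coe_mk, AddHom.coe_mk]
        congr 1
        simp
        linear_combination (x 0 ^ 2 + x 1 ^ 2) * Real.sin_sq_add_cos_sq α } rfl

lemma polarRotation_apply (α : ℝ) (x : R3) :
    polarRotation α x = !₂[Real.cos α * x 0 - Real.sin α * x 1,
        Real.sin α * x 0 + Real.cos α * x 1, x 2] := rfl

lemma wForm_polarRotation {s : ℂ} (hs : s = Complex.I ∨ s = -Complex.I) (α : ℝ) (x : R3) :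
    wForm s (polarRotation α x) = Complex.exp (s * α) * wForm s x := by
  have he : Complex.exp (s * α) = Complex.cos α + s * Complex.sin α := by
    rcases hs with rfl | rfl
    · rw [mul_comm, Complex.exp_mul_I, mul_comm Complex.I]
    · rw [show -Complex.I * (α : ℂ) = (-α : ℂ) * Complex.I by ring, Complex.exp_mul_I,
        Complex.cos_neg, Complex.sin_neg]
      ring
  have hs2 : s ^ 2 = -1 := by rcases hs with rfl | rfl <;> simp
  rw [he, wForm_apply, wForm_apply, polarRotation_apply]
  simp
  linear_combination -(Complex.sin α * x 1) * hs2

lemma signI_eq (m : ℤ) : signI m = Complex.I ∨ signI m = -Complex.I := by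
  unfold signI
  split_ifs <;> simp

lemma natAbs_mul_signI (m : ℤ) : (m.natAbs : ℂ) * signI m = m * Complex.I := by
  unfold signI
  split_ifs with h
  · rw [← Int.cast_natCast, Int.natAbs_of_nonneg h]
  · rw [← Int.cast_natCast, Int.ofNat_natAbs_of_nonpos (by omega)]
    push_cast
    ring

lemma sphericalHarmonic_polarRotation (l : ℕ) (m : ℤ) (α : ℝ) (x : S2) :
    sphericalHarmonic l m (S2.map (polarRotation α) x) =
      Complex.exp (m * Complex.I * α) * sphericalHarmonic l m x := by
  have hc : (S2.map (polarRotation α) x : R3) = polarRotation α x := rfl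
  have hz : zForm (polarRotation α x) = zForm x := by
    simp [zForm_apply, polarRotation_apply]
  rw [sphericalHarmonic_eq_sectorial]
  simp only [sectorial, hc, hz]
  rw [wForm_polarRotation (signI_eq m), mul_pow, ← Complex.exp_nat_mul,
    ← mul_assoc (m.natAbs : ℂ), natAbs_mul_signI]
  ring

/-- Rotation about the axis by `π/(m - n)` preserves the integral but multiplies the integrand by
`-1`. -/
lemma sphereInner_harmonic_of_ne (l k : ℕ) {m n : ℤ} (h : m ≠ n) :
    sphereInner (sphericalHarmonic l m) (sphericalHarmonic k n) = 0 := by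
  set α : ℝ := Real.pi / (m - n) with hα
  have hmn : (m - n : ℂ) ≠ 0 := sub_ne_zero.mpr (by exact_mod_cast h)
  have hrot := integral_comp_map (polarRotation α)
    (f := fun x => sphericalHarmonic l m x * starRingEnd ℂ (sphericalHarmonic k n x))
    ((continuous_sphericalHarmonic l m).mul
      (Complex.continuous_conj.comp (continuous_sphericalHarmonic k n)))
  have he : Complex.exp (m * Complex.I * α) * starRingEnd ℂ (Complex.exp (n * Complex.I * α)) =
      -1 := by
    rw [← Complex.exp_conj, ← Complex.exp_add, ← Complex.exp_pi_mul_I]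
    congr 1
    simp [hα]
    field_simp
    ring
  have h2 : ∀ x, sphericalHarmonic l m (S2.map (polarRotation α) x) *
      starRingEnd ℂ (sphericalHarmonic k n (S2.map (polarRotation α) x)) =
      -1 * (sphericalHarmonic l m x * starRingEnd ℂ (sphericalHarmonic k n x)) := by
    intro x
    rw [sphericalHarmonic_polarRotation, sphericalHarmonic_polarRotation, map_mul, ← he]
    ring
  simp_rw [h2, integral_const_mul] at hrot
  rw [sphereInner]
  linear_combination -(1 / 2 : ℂ) * hrot

lemma exists_sphericalHarmonic_ne_zero {l : ℕ} {m : ℤ} (hm : m ∈ Finset.Icc (-(l : ℤ)) l) :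
    ∃ x, sphericalHarmonic l m x ≠ 0 := by
  obtain ⟨n, hn⟩ : ∃ n, l = n + m.natAbs := ⟨l - m.natAbs, by rw [Finset.mem_Icc] at hm; omega⟩
  have hq : legendreDeriv l m.natAbs ≠ 0 := by
    rw [← Polynomial.degree_ne_bot, hn, degree_legendreDeriv]
    simp
  have hfin : {t : ℝ | (legendreDeriv l m.natAbs).IsRoot (t : ℂ)}.Finite :=
    (Polynomial.finite_setOfPred_isRoot hq).preimage Complex.ofReal_injective.injOn
  -- A height strictly between equator and pole that avoids the finitely many roots of `q`; there
  -- `x₀ ± i x₁` does not vanish either.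
  obtain ⟨t, ht, ht'⟩ := ((Set.Ioo_infinite (zero_lt_one' ℝ)).sdiff hfin).nonempty
  have h1 : 0 < 1 - t ^ 2 := by nlinarith [ht.1, ht.2]
  have hx : (!₂[Real.sqrt (1 - t ^ 2), 0, t] : R3) ∈ Metric.sphere (0 : R3) 1 := by
    rw [mem_sphere_zero_iff_norm, EuclideanSpace.norm_eq, Fin.sum_univ_three]
    simp [Real.sq_sqrt h1.le]
  refine ⟨⟨_, hx⟩, ?_⟩
  rw [sphericalHarmonic_eq_sectorial]
  refine mul_ne_zero (harmonicConst_ne_zero l m) (mul_ne_zero (pow_ne_zero _ ?_) ?_)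
  · simpa [wForm_apply] using (Real.sqrt_pos.mpr h1).ne'
  · simpa [zForm_apply] using ht'

/-- The square of the norm of `Y_l^m`. -/
noncomputable def harmonicNormSq (l : ℕ) (m : ℤ) : ℝ := sphereNormSq (sphericalHarmonic l m)

lemma harmonicNormSq_pos {l : ℕ} {m : ℤ} (hm : m ∈ Finset.Icc (-(l : ℤ)) l) :
    0 < harmonicNormSq l m :=
  sphereNormSq_pos (continuous_sphericalHarmonic l m) (exists_sphericalHarmonic_ne_zero hm)

lemma sphereInner_harmonic_self (l : ℕ) (m : ℤ) :
    sphereInner (sphericalHarmonic l m) (sphericalHarmonic l m) = harmonicNormSq l m :=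
  sphereInner_self _

/-! ### Coefficients, reproducing kernels and sup norm bounds -/

/-- The coefficients of a function on the sphere in its expansion in spherical harmonics. -/
noncomputable def harmonicCoeff (f : S2 → ℂ) (l : ℕ) (m : ℤ) : ℂ :=
  sphereInner f (sphericalHarmonic l m) / harmonicNormSq l m

lemma eq_of_forall_harmonicCoeff_eq {f g : S2 → ℂ} (hf : Continuous f) (hg : Continuous g)
    (h : ∀ l : ℕ, ∀ m ∈ Finset.Icc (-(l : ℤ)) l, harmonicCoeff f l m = harmonicCoeff g l m) :
    f = g := by
  have h0 := eq_zero_of_forall_sphereInner_harmonic (hf.sub hg) fun l m hm => by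
    have h1 := h l m hm
    have h2 : (harmonicNormSq l m : ℂ) ≠ 0 := by exact_mod_cast (harmonicNormSq_pos hm).ne'
    rw [harmonicCoeff, harmonicCoeff, div_left_inj' h2] at h1
    exact (sphereInner_sub_left hf hg (continuous_sphericalHarmonic l m)).trans
      (sub_eq_zero.mpr h1)
  exact sub_eq_zero.mp h0

lemma sphereInner_sum_harmonic (b : ℤ → ℂ) (l k : ℕ) (n : ℤ) :
    sphereInner (fun x => ∑ m ∈ Finset.Icc (-(l : ℤ)) l, b m * sphericalHarmonic l m x)
      (sphericalHarmonic k n) =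
      if l = k ∧ n ∈ Finset.Icc (-(l : ℤ)) l then b n * harmonicNormSq k n else 0 := by
  rw [sphereInner_sum_left _ (fun m _ => (continuous_sphericalHarmonic l m).const_mul (b m))
    (continuous_sphericalHarmonic k n)]
  simp_rw [sphereInner_const_mul_left]
  by_cases hl : l = k
  · subst hl
    have : ∀ m ∈ Finset.Icc (-(l : ℤ)) l,
        b m * sphereInner (sphericalHarmonic l m) (sphericalHarmonic l n) =
        if m = n then b n * harmonicNormSq l n else 0 := by
      intro m _
      split_ifs with hmn
      · rw [hmn, sphereInner_harmonic_self]
      · rw [sphereInner_harmonic_of_ne l l hmn, mul_zero]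
    rw [Finset.sum_congr rfl this, Finset.sum_ite_eq']
    simp
  · rw [if_neg fun h => hl h.1]
    exact Finset.sum_eq_zero fun m _ => by
      rw [(isHarmonicOfDegree_sphericalHarmonic l m).sphereInner_eq_zero hl, mul_zero]

/-- Both sides have the same coefficients, those of degree `k ≠ l` being zero by orthogonality;
completeness concludes. Thus the eigenspace is spanned by the `Y_l^m`. -/
lemma IsHarmonicOfDegree.eq_sum {l : ℕ} {f : S2 → ℂ} (hf : IsHarmonicOfDegree l f) :
    f = fun x => ∑ m ∈ Finset.Icc (-(l : ℤ)) l, harmonicCoeff f l m * sphericalHarmonic l m x := by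
  refine eq_of_forall_harmonicCoeff_eq hf.regular.continuous (continuous_finsetSum _ fun m _ =>
    (continuous_sphericalHarmonic l m).const_mul _) fun k n hn => ?_
  simp only [harmonicCoeff]
  rw [sphereInner_sum_harmonic]
  split_ifs with h
  · obtain ⟨rfl, _⟩ := h
    have : (harmonicNormSq l n : ℂ) ≠ 0 := by exact_mod_cast (harmonicNormSq_pos hn).ne'
    field_simp
  · rw [hf.sphereInner_eq_zero fun hlk => h ⟨hlk, hlk ▸ hn⟩]

/-- The reproducing kernel of the eigenspace of degree `l`. -/
noncomputable def harmonicKernel (l : ℕ) (y x : S2) : ℂ :=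
  ∑ m ∈ Finset.Icc (-(l : ℤ)) l,
    (starRingEnd ℂ (sphericalHarmonic l m y) / harmonicNormSq l m) * sphericalHarmonic l m x

lemma isHarmonicOfDegree_harmonicKernel (l : ℕ) (y : S2) :
    IsHarmonicOfDegree l (harmonicKernel l y) :=
  .sum fun m _ => (isHarmonicOfDegree_sphericalHarmonic l m).const_mul _

lemma IsHarmonicOfDegree.sphereInner_harmonicKernel {l : ℕ} {f : S2 → ℂ}
    (hf : IsHarmonicOfDegree l f) (y : S2) : sphereInner f (harmonicKernel l y) = f y := by
  conv_rhs => rw [hf.eq_sum]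
  unfold harmonicKernel
  rw [sphereInner_sum_right _ hf.regular.continuous fun m _ =>
    (continuous_sphericalHarmonic l m).const_mul _]
  refine Finset.sum_congr rfl fun m _ => ?_
  rw [sphereInner_const_mul_right, harmonicCoeff, map_div₀, Complex.conj_conj, Complex.conj_ofReal]
  ring

lemma sphereInner_comp_map (R : R3 ≃ₗᵢ[ℝ] R3) {f g : S2 → ℂ} (hf : Continuous f)
    (hg : Continuous g) : sphereInner (f ∘ S2.map R) (g ∘ S2.map R) = sphereInner f g :=
  integral_comp_map R (f := fun x => f x * starRingEnd ℂ (g x))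
    (hf.mul (Complex.continuous_conj.comp hg))

lemma S2.map_symm_map (R : R3 ≃ₗᵢ[ℝ] R3) (x : S2) : S2.map R.symm (S2.map R x) = x := by
  ext1
  simp [S2.map]

/-- Uniqueness of the reproducing kernel: the rotated kernel also lies in the eigenspace and
reproduces values at `y`, so the difference of the two kernels is orthogonal to itself. -/
lemma harmonicKernel_map (l : ℕ) (R : R3 ≃ₗᵢ[ℝ] R3) (y x : S2) :
    harmonicKernel l (S2.map R y) (S2.map R x) = harmonicKernel l y x := by
  have h1 : IsHarmonicOfDegree l (harmonicKernel l (S2.map R y) ∘ S2.map R) :=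
    (isHarmonicOfDegree_harmonicKernel l (S2.map R y)).comp_map R
  have h2 := isHarmonicOfDegree_harmonicKernel l y
  have hr : ∀ f, IsHarmonicOfDegree l f →
      sphereInner f (harmonicKernel l (S2.map R y) ∘ S2.map R) = f y := by
    intro f hf
    have hf' := hf.comp_map R.symm
    have hff : f = (f ∘ S2.map R.symm) ∘ S2.map R := by
      funext z
      simp [S2.map_symm_map]
    conv_lhs => rw [hff]
    rw [sphereInner_comp_map R hf'.regular.continuous
      (isHarmonicOfDegree_harmonicKernel l _).regular.continuous, hf'.sphereInner_harmonicKernel]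
    simp [S2.map_symm_map]
  have hd := h1.sub h2
  have h0 : sphereInner (fun x => (harmonicKernel l (S2.map R y) ∘ S2.map R) x -
      harmonicKernel l y x) (fun x => (harmonicKernel l (S2.map R y) ∘ S2.map R) x -
      harmonicKernel l y x) = 0 := by
    rw [← sphereInner_conj, sphereInner_sub_left h1.regular.continuous h2.regular.continuous
      hd.regular.continuous, ← sphereInner_conj _ (harmonicKernel l (S2.map R y) ∘ S2.map R),
      ← sphereInner_conj _ (harmonicKernel l y), hr _ hd, hd.sphereInner_harmonicKernel, sub_self,
      map_zero]
  exact sub_eq_zero.mp (congrFun (eq_zero_of_sphereInner_self hd.regular.continuous h0) x)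

/-- Isometries act transitively on the sphere: the reflection in the hyperplane orthogonal to `y -
x` carries `y` to `x`. -/
lemma harmonicKernel_self (l : ℕ) (x y : S2) : harmonicKernel l x x = harmonicKernel l y y := by
  have h : S2.map (Submodule.reflection (ℝ ∙ ((y : R3) - x))ᗮ) y = x := by
    ext1
    exact Submodule.reflection_sub (by rw [x.norm_coe, y.norm_coe])
  rw [← harmonicKernel_map l (Submodule.reflection (ℝ ∙ ((y : R3) - x))ᗮ) y y, h]

lemma harmonicKernel_self_eq (l : ℕ) (x : S2) :
    harmonicKernel l x x = ((∑ m ∈ Finset.Icc (-(l : ℤ)) l,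
      ‖sphericalHarmonic l m x‖ ^ 2 / harmonicNormSq l m : ℝ) : ℂ) := by
  rw [harmonicKernel, Complex.ofReal_sum]
  refine Finset.sum_congr rfl fun m _ => ?_
  rw [div_mul_eq_mul_div, mul_comm, Complex.mul_conj, Complex.normSq_eq_norm_sq]
  push_cast
  rfl

/-- The sum is the kernel on the diagonal, hence constant in `x`; integrating it counts `2l + 1`
summands of integral 1. -/
lemma sum_norm_sq_harmonic (l : ℕ) (x : S2) :
    (∑ m ∈ Finset.Icc (-(l : ℤ)) l, ‖sphericalHarmonic l m x‖ ^ 2 / harmonicNormSq l m) *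
      sphereMeasure.real Set.univ = 2 * l + 1 := by
  set κ := ∑ m ∈ Finset.Icc (-(l : ℤ)) l, ‖sphericalHarmonic l m x‖ ^ 2 / harmonicNormSq l m
    with hκ
  have h1 : ∀ y, ∑ m ∈ Finset.Icc (-(l : ℤ)) l,
      ‖sphericalHarmonic l m y‖ ^ 2 / harmonicNormSq l m = κ := by
    intro y
    have := harmonicKernel_self l y x
    rw [harmonicKernel_self_eq, harmonicKernel_self_eq] at this
    exact_mod_cast this
  have h2 : ∫ y, (∑ m ∈ Finset.Icc (-(l : ℤ)) l,
      ‖sphericalHarmonic l m y‖ ^ 2 / harmonicNormSq l m) ∂sphereMeasure =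
      ∑ m ∈ Finset.Icc (-(l : ℤ)) (l : ℤ), (1 : ℝ) := by
    rw [integral_finsetSum]
    · refine Finset.sum_congr rfl fun m hm => ?_
      rw [integral_div]
      exact div_self (harmonicNormSq_pos hm).ne'
    · intro m _
      have hc : Continuous fun y => ‖sphericalHarmonic l m y‖ ^ 2 / harmonicNormSq l m :=
        ((continuous_sphericalHarmonic l m).norm.pow 2).div_const _
      exact hc.integrable_of_hasCompactSupport (HasCompactSupport.of_compactSpace _)
  simp_rw [h1] at h2
  rw [integral_const, smul_eq_mul, mul_comm] at h2
  rw [h2]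
  simp
  have : ((l : ℤ) + 1 + l).toNat = 2 * l + 1 := by omega
  rw [this]
  push_cast
  ring

lemma sphereMeasure_univ_pos : 0 < sphereMeasure.real Set.univ := by
  rw [measureReal_def, ENNReal.toReal_pos_iff]
  exact ⟨isOpen_univ.measure_pos _ ⟨northPole, trivial⟩, measure_lt_top _ _⟩

/-- A sup norm bound for the spherical harmonics. -/
lemma norm_sq_sphericalHarmonic_le {l : ℕ} {m : ℤ} (hm : m ∈ Finset.Icc (-(l : ℤ)) l) (x : S2) :
    ‖sphericalHarmonic l m x‖ ^ 2 * sphereMeasure.real Set.univ ≤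
      (2 * l + 1) * harmonicNormSq l m := by
  have h1 := Finset.single_le_sum (s := Finset.Icc (-(l : ℤ)) l)
    (f := fun m => ‖sphericalHarmonic l m x‖ ^ 2 / harmonicNormSq l m)
    (fun m hm => div_nonneg (sq_nonneg _) (harmonicNormSq_pos hm).le) hm
  rw [div_le_iff₀ (harmonicNormSq_pos hm)] at h1
  rw [← sum_norm_sq_harmonic l x, mul_right_comm]
  exact mul_le_mul_of_nonneg_right h1 sphereMeasure_univ_pos.le

/-! ### Decay of coefficients and convergence of expansions -/

lemma harmonicCoeff_iterate_sphereLaplacian {f : S2 → ℂ} (hf : IsRegularOnSphere f) (k l : ℕ)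
    (m : ℤ) : harmonicCoeff (sphereLaplacian^[k] f) l m =
      sphereEigenvalue l ^ k * harmonicCoeff f l m := by
  induction k with
  | zero => simp
  | succ k ih =>
    rw [Function.iterate_succ_apply', harmonicCoeff,
      sphereInner_sphereLaplacian_harmonic (hf.iterate_sphereLaplacian k), mul_div_assoc,
      ← harmonicCoeff, ih, pow_succ]
    ring

/-- The bound on `|Y_l^m|` enters twice, through the integral and through the value at `x`, and the
unknown norm and total mass cancel. -/
lemma norm_harmonicCoeff_mul_le {f : S2 → ℂ} {M : ℝ} (hM : ∀ x, ‖f x‖ ≤ M) {l : ℕ} {m : ℤ}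
    (hm : m ∈ Finset.Icc (-(l : ℤ)) l) (x : S2) :
    ‖harmonicCoeff f l m * sphericalHarmonic l m x‖ ≤ M * (2 * l + 1) := by
  set N := harmonicNormSq l m
  set μ := sphereMeasure.real Set.univ
  have hN : 0 < N := harmonicNormSq_pos hm
  have hμ : 0 < μ := sphereMeasure_univ_pos
  have hM0 : 0 ≤ M := (norm_nonneg _).trans (hM x)
  set B := Real.sqrt ((2 * l + 1) * N / μ)
  have hY : ∀ y, ‖sphericalHarmonic l m y‖ ≤ B := fun y => by
    refine Real.le_sqrt_of_sq_le ?_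
    rw [le_div_iff₀ hμ]
    exact norm_sq_sphericalHarmonic_le hm y
  have hB : B * B = (2 * l + 1) * N / μ := Real.mul_self_sqrt (by positivity)
  have h1 : ‖sphereInner f (sphericalHarmonic l m)‖ ≤ M * B * μ :=
    norm_integral_le_of_norm_le_const (Filter.Eventually.of_forall fun y => by
      rw [norm_mul, RCLike.norm_conj]
      exact mul_le_mul (hM y) (hY y) (norm_nonneg _) hM0)
  rw [norm_mul, harmonicCoeff, norm_div, Complex.norm_real, Real.norm_of_nonneg hN.le]
  calc ‖sphereInner f (sphericalHarmonic l m)‖ / N * ‖sphericalHarmonic l m x‖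
      ≤ M * B * μ / N * B := by gcongr; exact hY x
    _ = M * (B * B) * μ / N := by ring
    _ = M * (2 * l + 1) := by rw [hB]; field_simp

/-- The expansion coefficients of a smooth function decay rapidly. -/
lemma exists_harmonicCoeff_decay {f : S2 → ℂ} (hf : IsRegularOnSphere f) (k : ℕ) :
    ∃ C, 0 ≤ C ∧ ∀ l : ℕ, ∀ m ∈ Finset.Icc (-(l : ℤ)) l, ∀ x,
      ‖harmonicCoeff f l m * sphericalHarmonic l m x‖ * ((l : ℝ) + 1) ^ k ≤ C := by
  -- One power of `△` beyond `k` pays for the factor `2l + 1`. Degree 0, where the eigenvalue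
  -- vanishes, is covered by the bound `M'` on `f` itself.
  obtain ⟨M, hM0, hM⟩ := exists_norm_le_of_continuous (hf.iterate_sphereLaplacian (k + 1)).continuous
  obtain ⟨M', hM0', hM'⟩ := exists_norm_le_of_continuous hf.continuous
  refine ⟨2 * M + M', by positivity, fun l m hm x => ?_⟩
  set t := ‖harmonicCoeff f l m * sphericalHarmonic l m x‖ with ht
  have ht0 : 0 ≤ t := norm_nonneg _
  rcases Nat.eq_zero_or_pos l with rfl | hl
  · have := norm_harmonicCoeff_mul_le hM' hm x
    simp only [CharP.cast_eq_zero, mul_zero, zero_add, mul_one, one_pow] at this ⊢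
    linarith
  · have h1 := norm_harmonicCoeff_mul_le hM hm x
    rw [harmonicCoeff_iterate_sphereLaplacian hf, mul_assoc, norm_mul, norm_pow, ← ht] at h1
    have hl1 : (1 : ℝ) ≤ l := by exact_mod_cast hl
    have h2 : (l : ℝ) + 1 ≤ ‖sphereEigenvalue l‖ := by
      rw [sphereEigenvalue, norm_neg, norm_mul, Complex.norm_natCast]
      have : ‖(l : ℂ) + 1‖ = l + 1 := by
        rw [← Nat.cast_add_one, Complex.norm_natCast]
        push_cast
        rfl
      rw [this]
      nlinarith
    have h3 : ((l : ℝ) + 1) ^ (k + 1) ≤ ‖sphereEigenvalue l‖ ^ (k + 1) := by gcongr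
    have h4 : ((l : ℝ) + 1) * (t * ((l : ℝ) + 1) ^ k) ≤ ((l : ℝ) + 1) * (2 * M + M') := by
      calc ((l : ℝ) + 1) * (t * ((l : ℝ) + 1) ^ k) = ((l : ℝ) + 1) ^ (k + 1) * t := by ring
        _ ≤ ‖sphereEigenvalue l‖ ^ (k + 1) * t := by gcongr
        _ ≤ M * (2 * l + 1) := h1
        _ ≤ ((l : ℝ) + 1) * (2 * M + M') := by nlinarith
    exact le_of_mul_le_mul_left h4 (by positivity)

lemma HasHarmonicExpansion.hasSum_continuousMap {b : ℕ → ℤ → ℂ} {f : S2 → ℂ}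
    (h : HasHarmonicExpansion b f) (hf : Continuous f) :
    HasSum (fun l : ℕ => ∑ m ∈ Finset.Icc (-(l : ℤ)) l, b l m • harmonicC l m)
      (⟨f, hf⟩ : C(S2, ℂ)) := by
  have h1 := tendstoUniformlyOn_univ.mp h.tendstoUniformlyOn
  unfold HasSum
  rw [ContinuousMap.tendsto_iff_tendstoUniformly]
  convert! h1 using 2 with s
  funext x
  simp [ContinuousMap.coe_sum, harmonicC]

/-- The coefficients of an expansion in spherical harmonics are determined by its sum. -/
lemma HasHarmonicExpansion.harmonicCoeff_eq {b : ℕ → ℤ → ℂ} {f : S2 → ℂ}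
    (h : HasHarmonicExpansion b f) (hf : Continuous f) {l : ℕ} {m : ℤ}
    (hm : m ∈ Finset.Icc (-(l : ℤ)) l) : harmonicCoeff f l m = b l m := by
  obtain ⟨T, hT⟩ := exists_clm_eq_sphereInner (continuous_sphericalHarmonic l m)
  have h1 := (h.hasSum_continuousMap hf).mapL T
  have h2 (k : ℕ) : T (∑ n ∈ Finset.Icc (-(k : ℤ)) k, b k n • harmonicC k n) =
      if k = l ∧ m ∈ Finset.Icc (-(k : ℤ)) k then b k m * harmonicNormSq l m else 0 := by
    rw [hT, ← sphereInner_sum_harmonic]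
    congr 1
    funext x
    simp [ContinuousMap.coe_sum, harmonicC]
  simp_rw [h2] at h1
  have h3 := h1.unique (hasSum_single l fun k hk => if_neg fun h => hk h.1)
  rw [if_pos ⟨rfl, hm⟩, hT] at h3
  have h4 : (harmonicNormSq l m : ℂ) ≠ 0 := by exact_mod_cast (harmonicNormSq_pos hm).ne'
  rw [harmonicCoeff, div_eq_iff h4]
  exact h3

lemma summable_const_div_sq (C : ℝ) : Summable fun l : ℕ => C / ((l : ℝ) + 1) ^ 2 := by
  have h := (summable_nat_add_iff 1).mpr
    (Real.summable_one_div_nat_pow.mpr (by norm_num : 1 < 2))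
  simpa [div_eq_mul_inv] using h.mul_left C

/-- Of the three spare powers of `l + 1`, one absorbs the `2l + 1` summands and two leave a summable
bound. -/
lemma norm_sum_Icc_le {l d : ℕ} {C A : ℝ} {f : ℤ → ℂ} {p : ℂ} (hA : 0 ≤ A)
    (hp : ‖p‖ ≤ A * ((l : ℝ) + 1) ^ d)
    (hf : ∀ m ∈ Finset.Icc (-(l : ℤ)) l, ‖f m‖ * ((l : ℝ) + 1) ^ (d + 3) ≤ C) :
    ‖p * ∑ m ∈ Finset.Icc (-(l : ℤ)) l, f m‖ ≤ 2 * A * C / ((l : ℝ) + 1) ^ 2 := by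
  have hl : 0 < (l : ℝ) + 1 := by positivity
  have h1 : ‖∑ m ∈ Finset.Icc (-(l : ℤ)) l, f m‖ ≤
      (2 * l + 1) * (C / ((l : ℝ) + 1) ^ (d + 3)) := by
    refine (norm_sum_le_of_le _ fun m hm => (le_div_iff₀ (by positivity)).mpr (hf m hm)).trans ?_
    rw [Finset.sum_const, nsmul_eq_mul, Int.card_Icc]
    have : ((l : ℤ) + 1 - -l).toNat = 2 * l + 1 := by omega
    rw [this]
    push_cast
    exact le_rfl
  have hC : 0 ≤ C := le_trans (by positivity) (hf 0 (by simp))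
  rw [norm_mul]
  calc ‖p‖ * ‖∑ m ∈ Finset.Icc (-(l : ℤ)) l, f m‖
      ≤ (A * ((l : ℝ) + 1) ^ d) * ((2 * (l + 1)) * (C / ((l : ℝ) + 1) ^ (d + 3))) := by
        gcongr
        refine h1.trans ?_
        gcongr
        linarith
    _ = 2 * A * C / ((l : ℝ) + 1) ^ 2 := by
        field_simp
        ring

/-- A smooth function on the sphere is the sum of its expansion in spherical harmonics. -/
lemma IsRegularOnSphere.hasHarmonicExpansion {f : S2 → ℂ} (hf : IsRegularOnSphere f) :
    HasHarmonicExpansion (harmonicCoeff f) f := by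
  obtain ⟨C, -, hC⟩ := exists_harmonicCoeff_decay hf 3
  have hb : ∀ (l : ℕ) (x : S2), x ∈ Set.univ →
      ‖∑ m ∈ Finset.Icc (-(l : ℤ)) l, harmonicCoeff f l m * sphericalHarmonic l m x‖ ≤
        2 * 1 * C / ((l : ℝ) + 1) ^ 2 := fun l x _ => by
    have := norm_sum_Icc_le (p := 1) (d := 0) zero_le_one (by simp) fun m hm => hC l m hm x
    simpa using this
  have hE : HasHarmonicExpansion (harmonicCoeff f) _ :=
    HasSumUniformlyOn.of_norm_le_summable (summable_const_div_sq (2 * 1 * C)) hb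
  have hg : Continuous fun x => ∑' l : ℕ, ∑ m ∈ Finset.Icc (-(l : ℤ)) l,
      harmonicCoeff f l m * sphericalHarmonic l m x :=
    continuous_tsum (fun l => continuous_finsetSum _ fun m _ =>
      (continuous_sphericalHarmonic l m).const_mul _) (summable_const_div_sq (2 * 1 * C))
      fun l x => hb l x trivial
  -- The series converges to some continuous function with the coefficients of `f`; completeness
  -- identifies it with `f`.
  have := eq_of_forall_harmonicCoeff_eq hg hf.continuous fun l m hm => hE.harmonicCoeff_eq hg hm
  rwa [this] at hE

lemma HasHarmonicExpansion.congr {b b' : ℕ → ℤ → ℂ} {f : S2 → ℂ} (h : HasHarmonicExpansion b f)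
    (hb : ∀ l : ℕ, ∀ m ∈ Finset.Icc (-(l : ℤ)) l, b l m = b' l m) : HasHarmonicExpansion b' f := by
  unfold HasHarmonicExpansion at *
  convert! h using 3 with l x
  exact Finset.sum_congr rfl fun m hm => by rw [hb l m hm]

/-! ### Laplace and Poisson equations, and `(△ + K)△ h = 0` -/

lemma polyLaplacian_eq (P : ℂ[X]) (f : S2 → ℂ) :
    polyLaplacian P f = fun x => ∑ k ∈ P.support, P.coeff k * sphereLaplacian^[k] f x := rfl

lemma IsRegularOnSphere.polyLaplacian {f : S2 → ℂ} (hf : IsRegularOnSphere f) (P : ℂ[X]) :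
    IsRegularOnSphere (polyLaplacian P f) :=
  .sum fun k _ => (hf.iterate_sphereLaplacian k).const_mul _

lemma harmonicCoeff_polyLaplacian {f : S2 → ℂ} (hf : IsRegularOnSphere f) (P : ℂ[X]) (l : ℕ)
    (m : ℤ) :
    harmonicCoeff (polyLaplacian P f) l m = P.eval (sphereEigenvalue l) * harmonicCoeff f l m := by
  rw [harmonicCoeff, polyLaplacian_eq, sphereInner_sum_left _
    (fun k _ => (hf.iterate_sphereLaplacian k).continuous.const_mul _)
    (continuous_sphericalHarmonic l m), Finset.sum_div, Polynomial.eval_eq_sum, Polynomial.sum,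
    Finset.sum_mul]
  refine Finset.sum_congr rfl fun k _ => ?_
  rw [sphereInner_const_mul_left, mul_div_assoc, ← harmonicCoeff,
    harmonicCoeff_iterate_sphereLaplacian hf, mul_assoc]

lemma hasSum_polyLaplacian {f : S2 → ℂ} (hf : IsRegularOnSphere f) (P : ℂ[X]) (x : S2) :
    HasSum (fun l : ℕ => P.eval (sphereEigenvalue l) *
      ∑ m ∈ Finset.Icc (-(l : ℤ)) l, harmonicCoeff f l m * sphericalHarmonic l m x)
      (polyLaplacian P f x) := by
  have h := (hf.polyLaplacian P).hasHarmonicExpansion.hasSum (Set.mem_univ x)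
  convert! h using 2 with l
  rw [Finset.mul_sum]
  refine Finset.sum_congr rfl fun m _ => ?_
  rw [harmonicCoeff_polyLaplacian hf, mul_assoc]

lemma harmonicCoeff_zero (l : ℕ) (m : ℤ) : harmonicCoeff (fun _ => 0) l m = 0 := by
  simp [harmonicCoeff, sphereInner]

lemma polyLaplacian_eq_zero_iff {f : S2 → ℂ} (hf : IsRegularOnSphere f) (P : ℂ[X]) :
    (∀ x, polyLaplacian P f x = 0) ↔ ∀ l : ℕ, ∀ m ∈ Finset.Icc (-(l : ℤ)) l,
      P.eval (sphereEigenvalue l) ≠ 0 → harmonicCoeff f l m = 0 := by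
  constructor
  · intro h l m _ hP
    have h1 := harmonicCoeff_polyLaplacian hf P l m
    rw [funext h, harmonicCoeff_zero] at h1
    exact (mul_eq_zero.mp h1.symm).resolve_left hP
  · intro h
    refine congrFun (eq_of_forall_harmonicCoeff_eq (hf.polyLaplacian P).continuous
      continuous_const fun l m hm => ?_)
    rw [harmonicCoeff_polyLaplacian hf, harmonicCoeff_zero]
    by_cases hP : P.eval (sphereEigenvalue l) = 0
    · rw [hP, zero_mul]
    · rw [h l m hm hP, mul_zero]

lemma polyLaplacian_eq_zero_iff_expansion (I : Set ℝ) (P : ℂ[X]) {h : ℝ → S2 → ℂ}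
    (hh : ∀ u ∈ I, IsRegularOnSphere (h u)) :
    (∀ u ∈ I, ∀ x : S2, polyLaplacian P (h u) x = 0) ↔
      ∃ a : ℕ → ℤ → ℝ → ℂ, ∀ u ∈ I, HasHarmonicExpansion (laplaceCoeff P a u) (h u) := by
  constructor
  · intro h0
    refine ⟨fun l m u => harmonicCoeff (h u) l m, fun u hu =>
      (hh u hu).hasHarmonicExpansion.congr fun l m hm => ?_⟩
    rw [laplaceCoeff]
    split_ifs with hP
    · rfl
    · exact (polyLaplacian_eq_zero_iff (hh u hu) P).mp (h0 u hu) l m hm hP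
  · rintro ⟨a, ha⟩ u hu
    refine (polyLaplacian_eq_zero_iff (hh u hu) P).mpr fun l m hm hP => ?_
    rw [(ha u hu).harmonicCoeff_eq (hh u hu).continuous hm, laplaceCoeff, if_neg hP]

lemma sphereLaplacian_const (c : ℂ) : sphereLaplacian (fun _ => c) = fun _ => 0 := by
  funext x
  have h : radialExtension (fun _ => c) =ᶠ[nhds (x : R3)] fun _ => c := by
    filter_upwards [isOpen_ne.mem_nhds x.coe_ne_zero] with y hy using radialExtension_of_ne _ hy
  rw [sphereLaplacian, (InnerProductSpace.laplacian_congr_nhds h).self_of_nhds]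
  simp

lemma isHarmonicOfDegree_const (c : ℂ) : IsHarmonicOfDegree 0 fun _ => c :=
  ⟨isRegularOnSphere_const c, by rw [sphereLaplacian_const]; simp [sphereEigenvalue]⟩

lemma iterate_sphereLaplacian_const (c : ℂ) (k : ℕ) :
    sphereLaplacian^[k] (fun _ => c) = fun _ => 0 ^ k * c := by
  induction k with
  | zero => simp
  | succ k ih => rw [Function.iterate_succ_apply', ih, sphereLaplacian_const]; simp

lemma polyLaplacian_const (P : ℂ[X]) (c : ℂ) (x : S2) :
    polyLaplacian P (fun _ => c) x = P.eval 0 * c := by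
  rw [polyLaplacian_eq, Polynomial.eval_eq_sum, Polynomial.sum, Finset.sum_mul]
  simp [iterate_sphereLaplacian_const, mul_assoc]

lemma IsRegularOnSphere.sub_const {f : S2 → ℂ} (hf : IsRegularOnSphere f) (c : ℂ) :
    IsRegularOnSphere fun x => f x - c := by
  simpa [sub_eq_add_neg] using hf.add (isRegularOnSphere_const (-c))

lemma iterate_sphereLaplacian_sub_const {f : S2 → ℂ} (hf : IsRegularOnSphere f) (c : ℂ) (k : ℕ) :
    sphereLaplacian^[k] (fun x => f x - c) = fun x => sphereLaplacian^[k] f x - 0 ^ k * c := by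
  induction k with
  | zero => simp
  | succ k ih =>
    have h := sphereLaplacian_add (hf.iterate_sphereLaplacian k)
      (isRegularOnSphere_const (-(0 ^ k * c)))
    simp only [sphereLaplacian_const, ← sub_eq_add_neg] at h
    rw [Function.iterate_succ_apply', ih, h, Function.iterate_succ_apply']
    simp

/-- Reduces the Poisson equation to the Laplace equation when `P(0) ≠ 0`, with `c = C(u) / P(0)`. -/
lemma polyLaplacian_sub_const {f : S2 → ℂ} (hf : IsRegularOnSphere f) (P : ℂ[X]) (c : ℂ)
    (x : S2) : polyLaplacian P (fun x => f x - c) x = polyLaplacian P f x - P.eval 0 * c := by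
  rw [← polyLaplacian_const P c x, polyLaplacian_eq, polyLaplacian_eq, polyLaplacian_eq,
    ← Finset.sum_sub_distrib]
  refine Finset.sum_congr rfl fun k _ => ?_
  rw [iterate_sphereLaplacian_sub_const hf, iterate_sphereLaplacian_const]
  ring

/-- A constant has coefficients in degree 0 only, and there `P(△)` multiplies by `P(0) = 0`. -/
lemma eq_zero_of_polyLaplacian_eq_const {f : S2 → ℂ} (hf : IsRegularOnSphere f) {P : ℂ[X]}
    (hP : P.eval 0 = 0) {c : ℂ} (h : ∀ x, polyLaplacian P f x = c) : c = 0 := by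
  have h1 : (fun _ : S2 => c) = fun _ => 0 := by
    refine eq_of_forall_harmonicCoeff_eq continuous_const continuous_const fun l m _ => ?_
    rw [harmonicCoeff_zero]
    rcases Nat.eq_zero_or_pos l with rfl | hl
    · rw [← funext h, harmonicCoeff_polyLaplacian hf]
      simp [sphereEigenvalue, hP]
    · rw [harmonicCoeff, (isHarmonicOfDegree_const c).sphereInner_eq_zero hl.ne, zero_div]
  exact congrFun h1 northPole

lemma sphericalHarmonic_zero_eq (x y : S2) : sphericalHarmonic 0 0 x = sphericalHarmonic 0 0 y := by
  simp [sphericalHarmonic, assocLegendre, assocLegendreNat, legendrePoly]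

lemma exists_degree_of_not_constant {f : S2 → ℂ} (hf : IsRegularOnSphere f) {K : ℂ}
    (h : ∀ x, sphereLaplacian (sphereLaplacian f) x + K * sphereLaplacian f x = 0)
    (hne : ∃ x y, f x ≠ f y) : ∃ l : ℕ, 1 ≤ l ∧ K = (l : ℂ) * ((l : ℂ) + 1) := by
  by_contra! hK
  obtain ⟨x, y, hxy⟩ := hne
  have hc : ∀ l : ℕ, 1 ≤ l → ∀ m, harmonicCoeff f l m = 0 := by
    intro l hl m
    have h1 : sphereLaplacian^[2] f = fun x => -K * sphereLaplacian^[1] f x := by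
      funext x
      have := h x
      simp only [Function.iterate_succ, Function.iterate_zero, Function.comp_apply, id]
      linear_combination this
    have h2 := harmonicCoeff_iterate_sphereLaplacian hf 2 l m
    rw [h1, harmonicCoeff, sphereInner_const_mul_left, mul_div_assoc, ← harmonicCoeff,
      harmonicCoeff_iterate_sphereLaplacian hf] at h2
    -- If `K` is none of the numbers `l(l+1)` with `l ≥ 1`, both factors in front are nonzero, so
    -- only degree 0 is left and `f` is constant.
    have h3 : sphereEigenvalue l * (sphereEigenvalue l + K) * harmonicCoeff f l m = 0 := by
      linear_combination -h2
    have h4 : sphereEigenvalue l ≠ 0 := by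
      rw [sphereEigenvalue, neg_ne_zero]
      exact_mod_cast (by positivity : l * (l + 1) ≠ 0)
    have h5 : sphereEigenvalue l + K ≠ 0 := fun h => hK l hl (by
      rw [sphereEigenvalue] at h
      linear_combination h)
    exact (mul_eq_zero.mp h3).resolve_left (mul_ne_zero h4 h5)
  have hx : ∀ x, f x = harmonicCoeff f 0 0 * sphericalHarmonic 0 0 x := by
    intro x
    have h1 := hf.hasHarmonicExpansion.hasSum (Set.mem_univ x)
    have h2 := h1.unique (hasSum_single 0 fun l hl => Finset.sum_eq_zero fun m _ => by
      rw [hc l (Nat.one_le_iff_ne_zero.mpr hl) m, zero_mul])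
    simpa using h2
  exact hxy (by rw [hx x, hx y, sphericalHarmonic_zero_eq x y])

/-! ### The heat equation -/

lemma exists_norm_eval_sphereEigenvalue_le (P : ℂ[X]) : ∃ (A : ℝ) (d : ℕ), 0 ≤ A ∧
    ∀ l : ℕ, ‖P.eval (sphereEigenvalue l)‖ ≤ A * ((l : ℝ) + 1) ^ d := by
  refine ⟨∑ k ∈ P.support, ‖P.coeff k‖, 2 * P.natDegree, by positivity, fun l => ?_⟩
  have hl : (1 : ℝ) ≤ (l : ℝ) + 1 := by
    have : (0 : ℝ) ≤ l := l.cast_nonneg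
    linarith
  have he : ‖sphereEigenvalue l‖ ≤ ((l : ℝ) + 1) ^ 2 := by
    have : ‖(l : ℂ) + 1‖ = l + 1 := by
      rw [← Nat.cast_add_one, Complex.norm_natCast]
      push_cast
      rfl
    rw [sphereEigenvalue, norm_neg, norm_mul, Complex.norm_natCast, this]
    nlinarith
  rw [Polynomial.eval_eq_sum, Polynomial.sum, Finset.sum_mul]
  refine norm_sum_le_of_le _ fun k hk => ?_
  rw [norm_mul, norm_pow]
  gcongr
  calc ‖sphereEigenvalue l‖ ^ k ≤ (((l : ℝ) + 1) ^ 2) ^ k := by gcongr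
    _ = ((l : ℝ) + 1) ^ (2 * k) := by rw [pow_mul]
    _ ≤ ((l : ℝ) + 1) ^ (2 * P.natDegree) :=
      pow_le_pow_right₀ hl (by have := Polynomial.le_natDegree_of_mem_supp k hk; omega)

/-- Differentiation of the coefficients of a heat solution. -/
lemma IsRegularHeatSolution.hasDerivAt_harmonicCoeff {I : Set ℝ} (hI : IsOpen I) {P Q : ℂ[X]}
    {h : ℝ → S2 → ℂ} (hh : IsRegularHeatSolution I P Q h) {u : ℝ} (hu : u ∈ I) (l : ℕ) (m : ℤ) :
    HasDerivAt (fun t => Q.eval (sphereEigenvalue l) * harmonicCoeff (h t) l m)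
      (P.eval (sphereEigenvalue l) * harmonicCoeff (h u) l m) u := by
  obtain ⟨ε, hε, hεI⟩ := Metric.nhds_basis_closedBall.mem_iff.mp (hI.mem_nhds hu)
  have hball : Metric.ball u ε ⊆ I := Metric.ball_subset_closedBall.trans hεI
  -- Joint continuity of `P(△)h` bounds it on a compact time interval times the sphere; this is the
  -- dominating constant for differentiation under the integral.
  obtain ⟨C, hC⟩ := ((isCompact_closedBall u ε).prod
    (isCompact_univ (X := S2))).exists_bound_of_continuousOn
    (hh.continuous_deriv.mono (Set.prod_mono hεI (Set.Subset.refl _)))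
  obtain ⟨B, -, hB⟩ := exists_norm_le_of_continuous (continuous_sphericalHarmonic l m)
  have hreg (R : ℂ[X]) {t : ℝ} (ht : t ∈ I) : Continuous fun x =>
      polyLaplacian R (h t) x * starRingEnd ℂ (sphericalHarmonic l m x) :=
    ((hh.regular t ht).polyLaplacian R).continuous.mul
      (Complex.continuous_conj.comp (continuous_sphericalHarmonic l m))
  have key := (hasDerivAt_integral_of_dominated_loc_of_deriv_le (μ := sphereMeasure) (x₀ := u)
    (F := fun t x => polyLaplacian Q (h t) x * starRingEnd ℂ (sphericalHarmonic l m x))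
    (F' := fun t x => polyLaplacian P (h t) x * starRingEnd ℂ (sphericalHarmonic l m x))
    (bound := fun _ => C * B) (Metric.ball_mem_nhds u hε)
    (by
      filter_upwards [Metric.ball_mem_nhds u hε] with t ht
      exact (hreg Q (hball ht)).aestronglyMeasurable)
    (integrable_sphere (hreg Q hu)) (hreg P hu).aestronglyMeasurable
    (Filter.Eventually.of_forall fun x t ht => by
      have h1 := hC (t, x) ⟨Metric.ball_subset_closedBall ht, trivial⟩
      rw [norm_mul, RCLike.norm_conj]
      exact mul_le_mul h1 (hB x) (norm_nonneg _) ((norm_nonneg _).trans h1))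
    (integrable_const _)
    (Filter.Eventually.of_forall fun x t ht => (hh.equation t (hball ht) x).mul_const _)).2
  have h2 := key.div_const (harmonicNormSq l m : ℂ)
  have hP : (∫ x, polyLaplacian P (h u) x * starRingEnd ℂ (sphericalHarmonic l m x)
      ∂sphereMeasure) / (harmonicNormSq l m : ℂ) =
      P.eval (sphereEigenvalue l) * harmonicCoeff (h u) l m :=
    harmonicCoeff_polyLaplacian (hh.regular u hu) P l m
  rw [hP] at h2
  refine h2.congr_of_eventuallyEq ?_
  filter_upwards [hI.mem_nhds hu] with t ht
  exact (harmonicCoeff_polyLaplacian (hh.regular t ht) Q l m).symm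

lemma eq_exp_of_hasDerivAt {I : Set ℝ} (hI : IsOpen I) (hI' : I.OrdConnected) {f : ℝ → ℂ} {r : ℂ}
    (hf : ∀ u ∈ I, HasDerivAt f (r * f u) u) :
    ∃ c : ℂ, ∀ u ∈ I, f u = c * Complex.exp (r * u) := by
  have hexp (u : ℝ) : HasDerivAt (fun t : ℝ => Complex.exp (-r * t))
      (Complex.exp (-r * u) * (-r)) u := by
    have h1 : HasDerivAt (fun t : ℝ => -r * (t : ℂ)) (-r) u := by
      simpa using (Complex.ofRealCLM.hasDerivAt (x := u)).const_mul (-r)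
    exact h1.cexp
  have hd : ∀ u ∈ I, HasDerivAt (fun t : ℝ => f t * Complex.exp (-r * t)) 0 u := by
    intro u hu
    have := (hf u hu).mul (hexp u)
    convert! this using 1
    ring
  obtain ⟨c, hc⟩ := hI.exists_is_const_of_deriv_eq_zero hI'.isPreconnected
    (fun u hu => (hd u hu).differentiableAt.differentiableWithinAt) fun u hu => (hd u hu).deriv
  refine ⟨c, fun u hu => ?_⟩
  rw [← hc u hu, mul_assoc, ← Complex.exp_add]
  simp

lemma IsRegularHeatSolution.exists_expansion {I : Set ℝ} (hI : IsOpen I) (hI' : I.OrdConnected)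
    {P Q : ℂ[X]} {h : ℝ → S2 → ℂ} (hh : IsRegularHeatSolution I P Q h) :
    ∃ (a : ℕ → ℤ → ℝ → ℂ) (c : ℕ → ℤ → ℂ),
      ∀ u ∈ I, HasHarmonicExpansion (heatCoeff P Q a c u) (h u) := by
  have hc (l : ℕ) (m : ℤ) : ∃ c : ℂ, l ∈ degreesSigma Q → ∀ u ∈ I,
      harmonicCoeff (h u) l m = c * Complex.exp (heatRate P Q l * u) := by
    by_cases hl : l ∈ degreesSigma Q
    · have hl' : Q.eval (sphereEigenvalue l) ≠ 0 := hl
      obtain ⟨c, hc⟩ := eq_exp_of_hasDerivAt hI hI' (f := fun u => harmonicCoeff (h u) l m)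
        (r := heatRate P Q l) fun u hu => by
          have h1 := (hh.hasDerivAt_harmonicCoeff hI hu l m).const_mul
            (Q.eval (sphereEigenvalue l))⁻¹
          simp only [inv_mul_cancel_left₀ hl'] at h1
          convert! h1 using 1
          rw [heatRate]
          ring
      exact ⟨c, fun _ => hc⟩
    · exact ⟨0, fun h => absurd h hl⟩
  choose c hc using hc
  refine ⟨fun l m u => harmonicCoeff (h u) l m, c, fun u hu =>
    (hh.regular u hu).hasHarmonicExpansion.congr fun l m _ => ?_⟩
  rw [heatCoeff]
  split_ifs with h1 h2
  · rfl
  · exact hc l m h2 u hu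
  -- Degrees in neither `Ξ` nor `Σ`: the differentiated function is identically 0 while `P(-l(l+1))
  -- ≠ 0`, so the coefficient vanishes.
  · have hQ : Q.eval (sphereEigenvalue l) = 0 := not_not.mp h2
    have hP : P.eval (sphereEigenvalue l) ≠ 0 := fun hP => h1 ⟨hP, hQ⟩
    have h3 := hh.hasDerivAt_harmonicCoeff hI hu l m
    simp only [hQ, zero_mul] at h3
    exact (mul_eq_zero.mp (h3.unique (hasDerivAt_const u 0))).resolve_left hP

open Classical in
/-- The term of degree `l` of the evolving part of a heat solution. -/
noncomputable def heatTerm (P Q : ℂ[X]) (c : ℕ → ℤ → ℂ) (l : ℕ) (u : ℝ) (x : S2) : ℂ :=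
  ∑ m ∈ Finset.Icc (-(l : ℤ)) l, (if l ∈ degreesSigma Q then
    c l m * Complex.exp (heatRate P Q l * u) else 0) * sphericalHarmonic l m x

/-- Used with `R = P` and `R = Q`, both of which vanish on the degrees of `Ξ`: the functions `a l
m`, possibly not even continuous in `u`, disappear. -/
lemma eval_mul_sum_heatCoeff {P Q R : ℂ[X]} {l : ℕ}
    (hR : l ∉ degreesSigma Q → l ∈ degreesXi P Q → R.eval (sphereEigenvalue l) = 0)
    (a : ℕ → ℤ → ℝ → ℂ) (c : ℕ → ℤ → ℂ) (u : ℝ) (x : S2) :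
    R.eval (sphereEigenvalue l) *
      ∑ m ∈ Finset.Icc (-(l : ℤ)) l, heatCoeff P Q a c u l m * sphericalHarmonic l m x =
      R.eval (sphereEigenvalue l) * heatTerm P Q c l u x := by
  by_cases h1 : l ∈ degreesSigma Q
  · have h2 : l ∉ degreesXi P Q := fun h => h1 h.2
    simp [heatTerm, heatCoeff, h1, h2]
  · by_cases h2 : l ∈ degreesXi P Q
    · simp [hR h1 h2]
    · simp [heatTerm, heatCoeff, h1, h2]

lemma hasDerivAt_heatTerm (P Q : ℂ[X]) (c : ℕ → ℤ → ℂ) (l : ℕ) (u : ℝ) (x : S2) :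
    HasDerivAt (fun t => Q.eval (sphereEigenvalue l) * heatTerm P Q c l t x)
      (P.eval (sphereEigenvalue l) * heatTerm P Q c l u x) u := by
  by_cases h1 : l ∈ degreesSigma Q
  · have hQ : Q.eval (sphereEigenvalue l) ≠ 0 := h1
    have hexp : HasDerivAt (fun t : ℝ => Complex.exp (heatRate P Q l * t))
        (Complex.exp (heatRate P Q l * u) * heatRate P Q l) u := by
      have h1 : HasDerivAt (fun t : ℝ => heatRate P Q l * (t : ℂ)) (heatRate P Q l) u := by
        simpa using (Complex.ofRealCLM.hasDerivAt (x := u)).const_mul (heatRate P Q l)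
      exact h1.cexp
    have h2 := (HasDerivAt.fun_sum (u := Finset.Icc (-(l : ℤ)) l) fun m _ =>
      ((hexp.const_mul (c l m)).mul_const (sphericalHarmonic l m x))).const_mul
        (Q.eval (sphereEigenvalue l))
    simp only [heatTerm, h1, if_true]
    convert! h2 using 1
    rw [Finset.mul_sum, Finset.mul_sum]
    refine Finset.sum_congr rfl fun m _ => ?_
    rw [heatRate]
    field_simp
  · simpa [heatTerm, h1] using hasDerivAt_const u (0 : ℂ)

lemma continuous_heatTerm (P Q : ℂ[X]) (c : ℕ → ℤ → ℂ) (l : ℕ) :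
    Continuous fun p : ℝ × S2 => heatTerm P Q c l p.1 p.2 := by
  refine continuous_finsetSum _ fun m _ => ?_
  refine Continuous.mul ?_ ((continuous_sphericalHarmonic l m).comp continuous_snd)
  split_ifs <;> fun_prop

/-- The modulus is monotone in `t`, so it is at most the larger of its end values; no bound on the
real part of `λ_l` is needed. -/
lemma norm_exp_mul_le (r : ℂ) {a b t : ℝ} (ha : a ≤ t) (hb : t ≤ b) :
    ‖Complex.exp (r * t)‖ ≤ ‖Complex.exp (r * a)‖ + ‖Complex.exp (r * b)‖ := by
  simp only [Complex.norm_exp, Complex.mul_re, Complex.ofReal_re, Complex.ofReal_im, mul_zero,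
    sub_zero]
  rcases le_total 0 r.re with h | h
  · have : r.re * t ≤ r.re * b := mul_le_mul_of_nonneg_left hb h
    linarith [Real.exp_le_exp.mpr this, Real.exp_pos (r.re * a)]
  · have : r.re * t ≤ r.re * a := mul_le_mul_of_nonpos_left ha h
    linarith [Real.exp_le_exp.mpr this, Real.exp_pos (r.re * b)]

/-- The terms of a heat solution are dominated by a summable sequence, locally uniformly in time,
even after multiplication by a polynomial in the eigenvalue. -/
lemma exists_summable_bound_heatTerm {P Q : ℂ[X]} {f g : S2 → ℂ} (hf : IsRegularOnSphere f)
    (hg : IsRegularOnSphere g) {a₁ a₂ : ℕ → ℤ → ℝ → ℂ} {c : ℕ → ℤ → ℂ} {a b : ℝ}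
    (hfa : HasHarmonicExpansion (heatCoeff P Q a₁ c a) f)
    (hgb : HasHarmonicExpansion (heatCoeff P Q a₂ c b) g) (R : ℂ[X]) :
    ∃ v : ℕ → ℝ, Summable v ∧ ∀ l, ∀ t ∈ Set.Icc a b, ∀ x,
      ‖R.eval (sphereEigenvalue l) * heatTerm P Q c l t x‖ ≤ v l := by
  obtain ⟨A, d, hA, hR⟩ := exists_norm_eval_sphereEigenvalue_le R
  -- The terms at the two end times are those of smooth functions; the exponent `d + 3` beats the
  -- growth of `R` and leaves `(l+1)^{-2}` after summing over `m`.
  obtain ⟨C, hC0, hC⟩ := exists_harmonicCoeff_decay hf (d + 3)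
  obtain ⟨D, hD0, hD⟩ := exists_harmonicCoeff_decay hg (d + 3)
  refine ⟨_, summable_const_div_sq (2 * A * (C + D)), fun l t ht x => ?_⟩
  refine norm_sum_Icc_le hA (hR l) fun m hm => ?_
  by_cases hl : l ∈ degreesSigma Q
  · have h2 : l ∉ degreesXi P Q := fun h => hl h.2
    have h3 := hC l m hm x
    have h4 := hD l m hm x
    rw [hfa.harmonicCoeff_eq hf.continuous hm, heatCoeff, if_neg h2, if_pos hl] at h3
    rw [hgb.harmonicCoeff_eq hg.continuous hm, heatCoeff, if_neg h2, if_pos hl] at h4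
    rw [if_pos hl]
    refine le_trans ?_ (add_le_add h3 h4)
    simp only [norm_mul]
    calc ‖c l m‖ * ‖Complex.exp (heatRate P Q l * t)‖ * ‖sphericalHarmonic l m x‖ *
        ((l : ℝ) + 1) ^ (d + 3)
        ≤ ‖c l m‖ * (‖Complex.exp (heatRate P Q l * a)‖ + ‖Complex.exp (heatRate P Q l * b)‖) *
          ‖sphericalHarmonic l m x‖ * ((l : ℝ) + 1) ^ (d + 3) := by
          gcongr
          exact norm_exp_mul_le _ ht.1 ht.2
      _ = _ := by ring
  · rw [if_neg hl]
    simp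
    positivity

lemma hasSum_polyLaplacian_heatTerm {P Q R : ℂ[X]}
    (hR : ∀ l, l ∉ degreesSigma Q → l ∈ degreesXi P Q → R.eval (sphereEigenvalue l) = 0)
    {f : S2 → ℂ} (hf : IsRegularOnSphere f) {a : ℕ → ℤ → ℝ → ℂ} {c : ℕ → ℤ → ℂ} {u : ℝ}
    (hE : HasHarmonicExpansion (heatCoeff P Q a c u) f) (x : S2) :
    HasSum (fun l : ℕ => R.eval (sphereEigenvalue l) * heatTerm P Q c l u x)
      (polyLaplacian R f x) := by
  have h := hasSum_polyLaplacian hf R x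
  convert! h using 2 with l
  rw [← eval_mul_sum_heatCoeff (hR l) a]
  congr 1
  exact Finset.sum_congr rfl fun m hm => by rw [hE.harmonicCoeff_eq hf.continuous hm]

/-- Termwise differentiation of the series for `Q(△)h`: the derived series is that of `P(△)h`, and a
locally uniform summable bound justifies the exchange and gives joint continuity. -/
lemma isRegularHeatSolution_of_expansion {I : Set ℝ} (hI : IsOpen I) {P Q : ℂ[X]}
    {h : ℝ → S2 → ℂ} (hreg : ∀ u ∈ I, IsRegularOnSphere (h u)) {a : ℕ → ℤ → ℝ → ℂ}
    {c : ℕ → ℤ → ℂ} (hE : ∀ u ∈ I, HasHarmonicExpansion (heatCoeff P Q a c u) (h u)) :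
    IsRegularHeatSolution I P Q h := by
  have hsum (R : ℂ[X]) (hR : ∀ l, l ∉ degreesSigma Q → l ∈ degreesXi P Q →
      R.eval (sphereEigenvalue l) = 0) {t : ℝ} (ht : t ∈ I) (x : S2) :
      HasSum (fun l : ℕ => R.eval (sphereEigenvalue l) * heatTerm P Q c l t x)
        (polyLaplacian R (h t) x) :=
    hasSum_polyLaplacian_heatTerm hR (hreg t ht) (hE t ht) x
  have hsumP {t : ℝ} (ht : t ∈ I) := hsum P (fun _ _ hl => hl.1) ht
  have hsumQ {t : ℝ} (ht : t ∈ I) := hsum Q (fun _ _ hl => hl.2) ht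
  have hloc : ∀ u ∈ I, ∃ α β : ℝ, u ∈ Set.Ioo α β ∧ Set.Icc α β ⊆ I ∧
      ∃ v : ℕ → ℝ, Summable v ∧ ∀ l, ∀ t ∈ Set.Icc α β, ∀ x,
        ‖P.eval (sphereEigenvalue l) * heatTerm P Q c l t x‖ ≤ v l := by
    intro u hu
    obtain ⟨ε, hε, hεI⟩ := Metric.nhds_basis_closedBall.mem_iff.mp (hI.mem_nhds hu)
    rw [Real.closedBall_eq_Icc] at hεI
    have hα : u - ε ∈ I := hεI ⟨le_rfl, by linarith⟩
    have hβ : u + ε ∈ I := hεI ⟨by linarith, le_rfl⟩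
    exact ⟨u - ε, u + ε, ⟨by linarith, by linarith⟩, hεI,
      exists_summable_bound_heatTerm (hreg _ hα) (hreg _ hβ) (hE _ hα) (hE _ hβ) P⟩
  refine ⟨hreg, fun u hu x => ?_, fun p hp => ?_⟩
  · obtain ⟨α, β, hu', hsub, v, hv, hbound⟩ := hloc u hu
    have h1 := hasDerivAt_tsum_of_isPreconnected hv isOpen_Ioo isPreconnected_Ioo
      (fun l t _ => hasDerivAt_heatTerm P Q c l t x)
      (fun l t ht => hbound l t (Set.Ioo_subset_Icc_self ht) x) hu' (hsumQ hu x).summable hu'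
    rw [(hsumP hu x).tsum_eq] at h1
    refine h1.congr_of_eventuallyEq ?_
    filter_upwards [hI.mem_nhds hu] with t ht using (hsumQ ht x).tsum_eq.symm
  · obtain ⟨α, β, hu', hsub, v, hv, hbound⟩ := hloc p.1 hp.1
    have h1 : ContinuousOn (fun q : ℝ × S2 => ∑' l : ℕ,
        P.eval (sphereEigenvalue l) * heatTerm P Q c l q.1 q.2) (Set.Ioo α β ×ˢ Set.univ) :=
      continuousOn_tsum (fun l => ((continuous_heatTerm P Q c l).const_mul _).continuousOn) hv
        fun l q hq => hbound l q.1 (Set.Ioo_subset_Icc_self hq.1) q.2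
    have hn : Set.Ioo α β ×ˢ (Set.univ : Set S2) ∈ nhds p :=
      (isOpen_Ioo.prod isOpen_univ).mem_nhds ⟨hu', trivial⟩
    refine ContinuousAt.continuousWithinAt ((h1.continuousAt hn).congr ?_)
    filter_upwards [hn] with q hq
    exact (hsumP (hsub (Set.Ioo_subset_Icc_self hq.1)) q.2).tsum_eq

lemma hasHarmonicExpansion_finite {b : ℕ → ℤ → ℂ} (L : Finset ℕ) (hb : ∀ l ∉ L, ∀ m, b l m = 0) :
    HasHarmonicExpansion b fun x => ∑ l ∈ L, ∑ m ∈ Finset.Icc (-(l : ℤ)) (l : ℤ),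
      b l m * sphericalHarmonic l m x := by
  unfold HasHarmonicExpansion
  rw [hasSumUniformlyOn_iff_tendstoUniformlyOn]
  intro U hU
  filter_upwards [Filter.eventually_ge_atTop L] with s hs x _
  rw [← Finset.sum_subset hs fun l _ hl => Finset.sum_eq_zero fun m _ => by rw [hb l hl, zero_mul]]
  exact refl_mem_uniformity hU

lemma isRegularHeatSolution_finite {I : Set ℝ} (hI : IsOpen I) (P Q : ℂ[X]) (L : Finset ℕ)
    (a : ℕ → ℤ → ℝ → ℂ) (c : ℕ → ℤ → ℂ) :
    IsRegularHeatSolution I P Q (fun u x =>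
      ∑ l ∈ L, ∑ m ∈ Finset.Icc (-(l : ℤ)) (l : ℤ),
        heatCoeff P Q a c u l m * sphericalHarmonic l m x) := by
  classical
  -- Setting the data to zero outside `L` makes the finite sum a full expansion, so the general
  -- criterion applies.
  let a' : ℕ → ℤ → ℝ → ℂ := fun l m u => if l ∈ L then a l m u else 0
  let c' : ℕ → ℤ → ℂ := fun l m => if l ∈ L then c l m else 0
  refine isRegularHeatSolution_of_expansion hI (a := a') (c := c')
    (fun u _ => .sum fun l _ => .sum fun m _ =>
      (isRegularOnSphere_sphericalHarmonic l m).const_mul _) fun u _ => ?_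
  have h := hasHarmonicExpansion_finite (b := heatCoeff P Q a' c' u) L fun l hl m => by
    simp [heatCoeff, a', c', hl]
  convert! h using 2 with x
  refine Finset.sum_congr rfl fun l hl => Finset.sum_congr rfl fun m _ => ?_
  simp [heatCoeff, a', c', hl]

theorem mainTheorem8 (I : Set ℝ) (hI : IsOpen I) (hI' : I.OrdConnected) :
    -- the polynomial heat equation
    (∀ (P Q : Polynomial ℂ) (h : ℝ → S2 → ℂ),
      IsRegularHeatSolution I P Q h ↔
        (∀ u ∈ I, IsRegularOnSphere (h u)) ∧
        ∃ (a : ℕ → ℤ → ℝ → ℂ) (c : ℕ → ℤ → ℂ),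
          ∀ u ∈ I, HasHarmonicExpansion (heatCoeff P Q a c u) (h u)) ∧
    -- the functions of `u` and the constants are arbitrary
    (∀ (P Q : Polynomial ℂ) (L : Finset ℕ) (a : ℕ → ℤ → ℝ → ℂ) (c : ℕ → ℤ → ℂ),
      IsRegularHeatSolution I P Q (fun u x =>
        ∑ l ∈ L, ∑ m ∈ Finset.Icc (-(l : ℤ)) (l : ℤ),
          heatCoeff P Q a c u l m * sphericalHarmonic l m x)) ∧
    -- the polynomial Laplace equation
    (∀ (P : Polynomial ℂ) (h : ℝ → S2 → ℂ), (∀ u ∈ I, IsRegularOnSphere (h u)) →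
      ((∀ u ∈ I, ∀ x : S2, polyLaplacian P (h u) x = 0) ↔
        ∃ a : ℕ → ℤ → ℝ → ℂ, ∀ u ∈ I, HasHarmonicExpansion (laplaceCoeff P a u) (h u))) ∧
    -- the polynomial Poisson equation
    (∀ (P : Polynomial ℂ) (C : ℝ → ℂ), (∃ u ∈ I, C u ≠ 0) → P.eval 0 = 0 →
      ¬ ∃ h : ℝ → S2 → ℂ, (∀ u ∈ I, IsRegularOnSphere (h u)) ∧
        ∀ u ∈ I, ∀ x : S2, polyLaplacian P (h u) x = C u) ∧
    (∀ (P : Polynomial ℂ) (C : ℝ → ℂ), P.eval 0 ≠ 0 →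
      ∀ h : ℝ → S2 → ℂ, (∀ u ∈ I, IsRegularOnSphere (h u)) →
      ((∀ u ∈ I, ∀ x : S2, polyLaplacian P (h u) x = C u) ↔
        ∃ a : ℕ → ℤ → ℝ → ℂ, ∀ u ∈ I,
          HasHarmonicExpansion (laplaceCoeff P a u) (fun x => h u x - C u / P.eval 0))) ∧
    -- the equation `(△ + K) △ h = 0`
    (∀ (K : ℂ) (h : ℝ → S2 → ℂ), (∀ u ∈ I, IsRegularOnSphere (h u)) →
      (∀ u ∈ I, ∀ x : S2,
        sphereLaplacian (sphereLaplacian (h u)) x + K * sphereLaplacian (h u) x = 0) →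
      (∃ u ∈ I, ∃ x y : S2, h u x ≠ h u y) →
      ∃ l : ℕ, 1 ≤ l ∧ K = (l : ℂ) * ((l : ℂ) + 1)) := by
  refine ⟨fun P Q h => ⟨fun hh => ⟨hh.regular, hh.exists_expansion hI hI'⟩, ?_⟩,
    isRegularHeatSolution_finite hI,
    fun P h hh => polyLaplacian_eq_zero_iff_expansion I P hh, ?_, ?_, ?_⟩
  · rintro ⟨hreg, a, c, hE⟩
    exact isRegularHeatSolution_of_expansion hI hreg hE
  · rintro P C ⟨u, hu, hC⟩ hP ⟨h, hreg, hh⟩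
    exact hC (eq_zero_of_polyLaplacian_eq_const (hreg u hu) hP (hh u hu))
  · intro P C hP h hreg
    rw [← polyLaplacian_eq_zero_iff_expansion I P fun u hu => (hreg u hu).sub_const _]
    refine forall₂_congr fun u hu => forall_congr' fun x => ?_
    rw [polyLaplacian_sub_const (hreg u hu), mul_div_cancel₀ _ hP, sub_eq_zero]
  · rintro K h hreg hh ⟨u, hu, hne⟩
    exact exists_degree_of_not_constant (hreg u hu) (hh u hu) hne
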